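/- Let $\pi=(\pi_i)_{i\ge 0}$ be a probability distribution on $\{0,1,2,\dots\}$ with $\sum_i i\pi_i=1$ and $\pi_1\ne 1$, and let $\alpha\in(1,2]$. Assume that there is a function $L_1$, slowly varying at infinity, such that $\sum_{i=0}^n i^2\pi_i=n^{2-\alpha}L_1(n)$ for all $n\ge 1$. (A function $\ell$ is slowly varying at infinity if it is measurable and $\ell(\lambda x)/\ell(x)\to1$ as $x\to\infty$ for every $\lambda>0$.) Let $f(s)=\sum_{i}\pi_i s^i$ and let $L$ be the function on $[1,\infty)$ determined by $f(s)=s+(1-s)^{\alpha}L\big((1-s)^{-1}\big)$ for $s\in[0,1)$. Let $\mathcal T$ be the following infinite random rooted plane tree. The root is special. All vertices have children independently of each other: a normal vertex has $k$ children with probability $\pi_k$, all of them normal; a special vertex has $k$ children with probability $k\pi_k$, one of which, chosen uniformly at random, is special while the others are normal. Let $\mathcal L$ be the looptree of $\mathcal T$: the graph with the same vertices as $\mathcal T$ in which consecutive siblings are joined by an edge and every vertex that has children is joined to its leftmost and to its rightmost child. Let $B(n;\mathcal L)$ be the set of vertices of $\mathcal L$ at graph distance less than $n$ from the root. Then for every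 sequence $(a_n)$ of real numbers, positive for $n\ge1$, with $a_n\sim n^{\alpha}L(n)^{-1}$ as $n\to\infty$, there are constants $k_1,k_2>0$ such that $$k_1a_n\le \mathbb E|B(n;\mathcal L)|\le k_2a_n\qquad\text{for all } n\ge 1.$$ Moreover the annealed volume growth exponent of $\mathcal L$ equals $\alpha$: $$\lim_{n\to\infty}\frac{\log \mathbb E|B(n;\mathcal L)|}{\log n}=\alpha.$$ -/

import Mathlib

open Filter Topology MeasureTheory
open scoped ENNReal

noncomputable section

namespace Looptree

/-! ### Plane trees and looptrees -/

/-- Vertices of the locally finite rooted plane tree in which the vertex `v` has `d v` children.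
The root is `[]` and the children of `v`, from left to right, are
`v ++ [0], …, v ++ [d v - 1]`.  So a list is a vertex if every step taken along it is allowed.
The values of `d` outside the tree are irrelevant. -/
def treeVerts (d : List ℕ → ℕ) : Set (List ℕ) :=
  {v | ∀ (w : List ℕ) (i : ℕ), (w ++ [i]) <+: v → i < d w}

/-- One orientation of each edge of the looptree: from a sibling to the next sibling on its right,
and from a parent to its leftmost child and to its rightmost child. -/
def LoopRel (d : List ℕ → ℕ) (u v : List ℕ) : Prop :=
  u ∈ treeVerts d ∧ v ∈ treeVerts d ∧
    ((∃ (w : List ℕ) (i : ℕ), u = w ++ [i] ∧ v = w ++ [i + 1]) ∨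
      v = u ++ [0] ∨
      (0 < d u ∧ v = u ++ [d u - 1]))

/-- The looptree of the plane tree with outdegrees `d`.  Its vertex set is `treeVerts d`; lists
that are not vertices of the tree are isolated points and never lie in a ball below. -/
def loopGraph (d : List ℕ → ℕ) : SimpleGraph (List ℕ) :=
  SimpleGraph.fromRel (LoopRel d)

/-- The ball `{x : dist(x, root) < R}` of the looptree, for its graph metric. -/
def loopBall (d : List ℕ → ℕ) (R : ℕ) : Set (List ℕ) :=
  {x | x ∈ treeVerts d ∧ (loopGraph d).edist [] x < (R : ℕ∞)}

/-! ### The modified (size-biased) Galton–Watson tree -/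

/-- `π` is critical: it has mean one. -/
def IsCritical (π : PMF ℕ) : Prop := ∑' k : ℕ, (k : ℝ≥0∞) * π k = 1

/-- The size-biased distribution `k ↦ k π_k` of a critical distribution. -/
def sizeBiased (π : PMF ℕ) (h : IsCritical π) : PMF ℕ :=
  ⟨fun k => (k : ℝ≥0∞) * π k, by
    have hs := (ENNReal.summable (f := fun k : ℕ => (k : ℝ≥0∞) * π k)).hasSum
    rwa [show ∑' k : ℕ, (k : ℝ≥0∞) * π k = 1 from h] at hs⟩

/-- Given the number `k` of children of a special vertex, a uniformly chosen child, recorded as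
the pair `(k, position)`.  The value at `k = 0` is irrelevant, as a size-biased variable is
positive. -/
def chooseSpecial : ℕ → PMF (ℕ × ℕ)
  | 0 => PMF.pure (0, 0)
  | k + 1 => (PMF.uniformOfFintype (Fin (k + 1))).map fun j : Fin (k + 1) => (k + 1, j.val)

/-- Joint law of the number of children of a special vertex and the position of its special
child. -/
def spineStep (π : PMF ℕ) (h : IsCritical π) : PMF (ℕ × ℕ) :=
  (sizeBiased π h).bind chooseSpecial

/-- The randomness of the tree: `ω.1 u` is the number of children of `u` if `u` is normal, and
`ω.2 n` is the number of children of the special vertex of generation `n` together with the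
position of its special child. -/
abbrev Sample : Type := (List ℕ → ℕ) × (ℕ → ℕ × ℕ)

/-- All offspring variables are independent, those of normal vertices with law `π`, those of
special vertices with the size-biased law and a uniformly chosen special child. -/
def sampleLaw (π : PMF ℕ) (h : IsCritical π) : Measure Sample :=
  (Measure.infinitePi fun _ : List ℕ => π.toMeasure).prod
    (Measure.infinitePi fun _ : ℕ => (spineStep π h).toMeasure)

/-- The special vertex of generation `n`. -/
def spine (ω : Sample) (n : ℕ) : List ℕ := (List.range n).map fun i => (ω.2 i).2

/-- Outdegrees of the modified Galton–Watson tree. -/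
def modifiedOutdeg (ω : Sample) (u : List ℕ) : ℕ :=
  if u = spine ω u.length then (ω.2 u.length).1 else ω.1 u

/-- The expected volume `E |B(n; 𝓛)|`, where `𝓛` is the looptree of the modified Galton–Watson
tree with critical offspring distribution `π`. -/
def expectedVolume (π : PMF ℕ) (h : IsCritical π) (n : ℕ) : ℝ≥0∞ :=
  ∫⁻ ω, ((loopBall (modifiedOutdeg ω) n).encard : ℝ≥0∞) ∂(sampleLaw π h)

/-! ### Domain of attraction -/

/-- Slow variation at infinity. -/
def SlowlyVarying (L : ℝ → ℝ) : Prop :=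
  Measurable L ∧ ∀ c : ℝ, 0 < c → Tendsto (fun x => L (c * x) / L x) atTop (𝓝 1)

/-- `∑_{i ≤ n} i² π_i = n^{2-α} L₁(n)` with `L₁` slowly varying at infinity. -/
def StableDomain (π : PMF ℕ) (α : ℝ) : Prop :=
  ∃ L₁ : ℝ → ℝ, SlowlyVarying L₁ ∧ ∀ n : ℕ, 1 ≤ n →
    ∑ i ∈ Finset.range (n + 1), (i : ℝ) ^ 2 * (π i).toReal = (n : ℝ) ^ (2 - α) * L₁ n

/-- The generating function of `π`. -/
def genFun (π : PMF ℕ) (s : ℝ) : ℝ := ∑' n : ℕ, (π n).toReal * s ^ n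

/-- The function `L` on `[1, ∞)` determined by `f(s) = s + (1 - s)^α L(1 / (1 - s))` for
`0 ≤ s < 1`, where `f` is the generating function of `π`. -/
def slowL (π : PMF ℕ) (α : ℝ) (x : ℝ) : ℝ :=
  x ^ α * (genFun π (1 - x⁻¹) - (1 - x⁻¹))

theorem genFun_eq_slowL (π : PMF ℕ) (α s : ℝ) (hs : s < 1) :
    genFun π s = s + (1 - s) ^ α * slowL π α (1 - s)⁻¹ := by
  have h1 : 0 < 1 - s := by linarith
  have h2 : (1 - s) ^ α ≠ 0 := (Real.rpow_pos_of_pos h1 α).ne'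
  rw [slowL, inv_inv, Real.inv_rpow h1.le, ← mul_assoc, mul_inv_cancel₀ h2, one_mul,
    sub_sub_cancel, add_sub_cancel]

end Looptree

end

/-!
The two-sided bound comes from elementary renewal estimates; regular variation enters through the
identification of the exponent.

The looptree distance from the root to a vertex is the sum, over its ancestral line, of the
distances `loopCost i k = min (i + 1) (k - i)` around the successive loops: `loopBall_eq`. Splitting
a ball at the root therefore yields renewal equations. Along the ancestral line of a vertex chosen
by the many-to-one formula, as well as along the spine, these distances are independent copies of
a variable `C`, the `loopCost` of a uniform child of a vertex with size-biased offspring. Let `U(n)`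
be the expected volume in the ordinary Galton–Watson looptree and `T(n)` the one in question. Then
`U(n) = 1 + E[U(n - C)]` and `T(n) = h(n) + E[T(n - C)]`, where `h(n)` is the expected number of
vertices near a special vertex among itself and the descendants of its normal children
(`gwVolume_eq`, `expectedVolume_eq`); both follow from the independence of a coordinate and the
remaining ones in an infinite product (`infinitePi_map_prodMk`).

As `C ≥ 1`, bounds propagate through these equations by induction on the radius. They give
`n ≤ U(n) E[min(C, n)] ≤ 2n`, and show that `T(n)` lies between `h(n/2) U(n/2)` and `h(n) U(n)`.
With `w(n) = ∑ k, k π_k min(k, n)` (`meanSize`), the loops satisfy `w(n) / 8 ≤ E[min(C, n)] ≤ w(n)`,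
and `h(n)` is of order `U(n) w(n)`. Hence `T(n)` is of order `n² / w(n)`
(`expectedVolume_mul_meanSize_le`, `le_expectedVolume_mul_meanSize`). Expanding `(1 - 1/n)^k` shows
that `f(1 - 1/n) - (1 - 1/n)` is of order `w(n) / n²`, and its inverse is exactly
`n^α / L(n)`, which proves the two-sided bound.

For the exponent, the truncated second moment `V` satisfies `V(2^{j+1}) / V(2^j) → 2^{2-α}`. This
gives `w(n) ≥ V(n) ≥ c n^γ` for `γ < 2 - α`. It also gives finite moments of every order `β < α`
by the ratio test, whence `w(n) ≤ M n^{2-β}` if `1 ≤ β`; such a `β` exists because `α > 1`.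
-/

noncomputable section

namespace Looptree

/-! ### The graph distance of a looptree -/

/-- The distance between a vertex with `k` children and its child number `i` (counted from `0`):
the two ways around the loop have lengths `i + 1` and `k - i`. -/
def loopCost (i k : ℕ) : ℕ := min (i + 1) (k - i)

/-- The outdegrees of the tree of descendants of the child number `i` of the root. -/
def subtreeDeg (d : List ℕ → ℕ) (i : ℕ) : List ℕ → ℕ := fun w => d (i :: w)

/-- The distance of a vertex from the root, as the sum of the distances between consecutive
ancestors.  That it is the graph distance is `loopBall_eq`. -/
def loopDepth : (List ℕ → ℕ) → List ℕ → ℕ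
  | _, [] => 0
  | d, i :: w => loopCost i (d []) + loopDepth (subtreeDeg d i) w

theorem nil_mem_treeVerts (d : List ℕ → ℕ) : [] ∈ treeVerts d := by
  intro w i h
  simp at h

theorem cons_mem_treeVerts {d : List ℕ → ℕ} {i : ℕ} {w : List ℕ} :
    i :: w ∈ treeVerts d ↔ i < d [] ∧ w ∈ treeVerts (subtreeDeg d i) := by
  constructor
  · intro h
    refine ⟨h [] i (by simp), fun u j huj => ?_⟩
    exact h (i :: u) j (by simpa using huj)
  · rintro ⟨h0, h⟩ u j huj
    cases u with
    | nil =>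
      simp only [List.nil_append, List.cons_prefix_cons] at huj
      rw [huj.1]; exact h0
    | cons a u =>
      simp only [List.cons_append, List.cons_prefix_cons] at huj
      obtain ⟨rfl, huj⟩ := huj
      exact h u j huj

theorem concat_mem_treeVerts {d : List ℕ → ℕ} {i : ℕ} {w : List ℕ} :
    w ++ [i] ∈ treeVerts d ↔ w ∈ treeVerts d ∧ i < d w := by
  induction w generalizing d with
  | nil => simp [cons_mem_treeVerts, nil_mem_treeVerts]
  | cons a w ih => simp [cons_mem_treeVerts, ih, and_assoc, subtreeDeg]

theorem loopDepth_concat (d : List ℕ → ℕ) (w : List ℕ) (i : ℕ) :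
    loopDepth d (w ++ [i]) = loopDepth d w + loopCost i (d w) := by
  induction w generalizing d with
  | nil => simp [loopDepth]
  | cons a w ih => simp [loopDepth, ih, subtreeDeg, add_assoc]

/-- `loopDepth` is `1`-Lipschitz along the edges of the looptree, so it bounds the graph distance
from below. -/
theorem loopDepth_of_loopRel {d : List ℕ → ℕ} {u v : List ℕ} (h : LoopRel d u v) :
    loopDepth d v ≤ loopDepth d u + 1 ∧ loopDepth d u ≤ loopDepth d v + 1 := by
  obtain ⟨hu, hv, ⟨w, i, rfl, rfl⟩ | rfl | ⟨h0, rfl⟩⟩ := h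
  · have h1 := (concat_mem_treeVerts.1 hv).2
    simp only [loopDepth_concat, loopCost]
    omega
  · simp only [loopDepth_concat, loopCost]
    omega
  · simp only [loopDepth_concat, loopCost]
    omega

theorem loopDepth_le_of_walk {d : List ℕ → ℕ} {u v : List ℕ} (p : (loopGraph d).Walk u v) :
    loopDepth d v ≤ loopDepth d u + p.length := by
  induction p with
  | nil => simp
  | cons hadj p ih =>
    rw [loopGraph, SimpleGraph.fromRel_adj] at hadj
    have := hadj.2.elim (fun h => (loopDepth_of_loopRel h).1) fun h => (loopDepth_of_loopRel h).2
    rw [SimpleGraph.Walk.length_cons]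
    omega

theorem edist_le_one_of_loopRel {d : List ℕ → ℕ} {u v : List ℕ} (h : LoopRel d u v) :
    (loopGraph d).edist u v ≤ 1 := by
  rw [SimpleGraph.edist_le_one_iff_adj_or_eq, loopGraph, SimpleGraph.fromRel_adj]
  tauto

/-- Going around a loop from its bottom, starting with the leftmost child. -/
theorem edist_concat_le_left {d : List ℕ → ℕ} {w : List ℕ} (hw : w ∈ treeVerts d) :
    ∀ i, i < d w → (loopGraph d).edist w (w ++ [i]) ≤ ((i + 1 : ℕ) : ℕ∞)
  | 0, h => by
    simpa using edist_le_one_of_loopRel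
      ⟨hw, concat_mem_treeVerts.2 ⟨hw, h⟩, Or.inr (Or.inl rfl)⟩
  | i + 1, h => by
    have h1 := edist_concat_le_left hw i (by omega)
    have h2 : (loopGraph d).edist (w ++ [i]) (w ++ [i + 1]) ≤ 1 := edist_le_one_of_loopRel
      ⟨concat_mem_treeVerts.2 ⟨hw, by omega⟩, concat_mem_treeVerts.2 ⟨hw, h⟩,
        Or.inl ⟨w, i, rfl, rfl⟩⟩
    refine SimpleGraph.edist_triangle.trans ((add_le_add h1 h2).trans ?_)
    push_cast
    exact le_rfl

/-- Going around a loop from its bottom, starting with the rightmost child. -/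
theorem edist_concat_le_right {d : List ℕ → ℕ} {w : List ℕ} (hw : w ∈ treeVerts d) :
    ∀ j i, i + j + 1 = d w → (loopGraph d).edist w (w ++ [i]) ≤ ((j + 1 : ℕ) : ℕ∞)
  | 0, i, h => by
    have hi : i = d w - 1 := by omega
    simpa using edist_le_one_of_loopRel
      ⟨hw, concat_mem_treeVerts.2 ⟨hw, by omega⟩, Or.inr (Or.inr ⟨by omega, by rw [hi]⟩)⟩
  | j + 1, i, h => by
    have h1 := edist_concat_le_right hw j (i + 1) (by omega)
    have h2 : (loopGraph d).edist (w ++ [i + 1]) (w ++ [i]) ≤ 1 := by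
      rw [SimpleGraph.edist_comm]
      exact edist_le_one_of_loopRel
        ⟨concat_mem_treeVerts.2 ⟨hw, by omega⟩, concat_mem_treeVerts.2 ⟨hw, by omega⟩,
          Or.inl ⟨w, i, rfl, rfl⟩⟩
    refine SimpleGraph.edist_triangle.trans ((add_le_add h1 h2).trans ?_)
    push_cast
    exact le_rfl

theorem edist_le_loopDepth {d : List ℕ → ℕ} (v : List ℕ) (hv : v ∈ treeVerts d) :
    (loopGraph d).edist [] v ≤ loopDepth d v := by
  induction v using List.reverseRecOn with
  | nil => simp
  | append_singleton w i ih =>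
    obtain ⟨hw, hi⟩ := concat_mem_treeVerts.1 hv
    have h1 := edist_concat_le_left hw i hi
    have h2 := edist_concat_le_right hw (d w - i - 1) i (by omega)
    have h3 : (loopGraph d).edist w (w ++ [i]) ≤ (loopCost i (d w) : ℕ∞) := by
      rcases min_choice (i + 1) (d w - i) with h | h
      · rw [loopCost, h]; exact h1
      · rw [loopCost, h]
        rwa [show d w - i - 1 + 1 = d w - i by omega] at h2
    rw [loopDepth_concat]
    refine SimpleGraph.edist_triangle.trans ((add_le_add (ih hw) h3).trans ?_)
    push_cast
    exact le_rfl

theorem loopBall_eq (d : List ℕ → ℕ) (R : ℕ) :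
    loopBall d R = {v | v ∈ treeVerts d ∧ loopDepth d v < R} := by
  ext v
  refine and_congr_right fun hv => ⟨fun h => ?_, fun h => ?_⟩
  · obtain ⟨p, hp⟩ := SimpleGraph.exists_walk_of_edist_ne_top h.ne_top
    have h1 := loopDepth_le_of_walk p
    rw [← hp] at h
    have h2 : p.length < R := by exact_mod_cast h
    simp only [loopDepth] at h1
    omega
  · exact (edist_le_loopDepth v hv).trans_lt (by exact_mod_cast h)

theorem cons_mem_loopBall {d : List ℕ → ℕ} {R i : ℕ} {w : List ℕ} :
    i :: w ∈ loopBall d R ↔ i < d [] ∧ w ∈ loopBall (subtreeDeg d i) (R - loopCost i (d [])) := by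
  simp only [loopBall_eq, Set.mem_ofPred_eq, cons_mem_treeVerts, loopDepth, and_assoc,
    lt_tsub_iff_left]

theorem nil_mem_loopBall {d : List ℕ → ℕ} {R : ℕ} : [] ∈ loopBall d R ↔ 0 < R := by
  simp [loopBall_eq, loopDepth, nil_mem_treeVerts]

theorem loopBall_mono (d : List ℕ → ℕ) {R S : ℕ} (h : R ≤ S) : loopBall d R ⊆ loopBall d S := by
  intro v hv
  exact ⟨hv.1, hv.2.trans_le (by exact_mod_cast h)⟩

/-! ### The volume of a ball -/

/-- The number of vertices in a ball of the looptree. -/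
def ballVolume (d : List ℕ → ℕ) (R : ℕ) : ℝ≥0∞ := ((loopBall d R).encard : ℝ≥0∞)

theorem ballVolume_eq_tsum (d : List ℕ → ℕ) (R : ℕ) :
    ballVolume d R = ∑' v, (loopBall d R).indicator 1 v := by
  rw [ballVolume, ← tsum_subtype (loopBall d R) (1 : List ℕ → ℝ≥0∞)]
  simp

theorem tsum_list (F : List ℕ → ℝ≥0∞) :
    ∑' v, F v = F [] + ∑' i, ∑' w, F (i :: w) := by
  have he : Function.Injective fun p : ℕ × List ℕ => p.1 :: p.2 := by
    rintro ⟨i, w⟩ ⟨j, x⟩ h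
    simpa using h
  rw [ENNReal.tsum_eq_add_tsum_ite [], ← he.tsum_eq, ENNReal.tsum_prod']
  · simp
  · rintro (_ | ⟨i, w⟩) h
    · simp at h
    · exact ⟨(i, w), rfl⟩

/-- Splitting a ball at the root: the ball of radius `R` consists of the root and of the balls of
radius `R - loopCost i k` in the looptrees of the `k` subtrees of the root. -/
theorem ballVolume_eq (d : List ℕ → ℕ) (R : ℕ) :
    ballVolume d R = (if 0 < R then 1 else 0) + ∑ i ∈ Finset.range (d []),
      ballVolume (subtreeDeg d i) (R - loopCost i (d [])) := by
  classical
  simp only [ballVolume_eq_tsum]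
  rw [tsum_list]
  congr 1
  · simp [Set.indicator_apply, nil_mem_loopBall]
  · rw [tsum_eq_sum (s := Finset.range (d []))]
    · refine Finset.sum_congr rfl fun i hi => tsum_congr fun w => ?_
      simp [Set.indicator_apply, cons_mem_loopBall, Finset.mem_range.1 hi]
    · intro i hi
      rw [Finset.mem_range] at hi
      simp [cons_mem_loopBall, hi]

theorem measurable_subtreeDeg (i : ℕ) : Measurable fun d : List ℕ → ℕ => subtreeDeg d i :=
  measurable_pi_lambda _ fun w => measurable_pi_apply (i :: w)

theorem measurableSet_mem_treeVerts (v : List ℕ) : MeasurableSet {d | v ∈ treeVerts d} := by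
  induction v with
  | nil => simp [nil_mem_treeVerts]
  | cons i w ih =>
    simp only [cons_mem_treeVerts]
    refine MeasurableSet.inter ?_ (measurable_subtreeDeg i ih)
    exact measurableSet_lt measurable_const (measurable_pi_apply _)

theorem measurable_loopDepth (v : List ℕ) : Measurable fun d => loopDepth d v := by
  induction v with
  | nil => exact measurable_const
  | cons i w ih =>
    simp only [loopDepth]
    refine Measurable.add ?_ (ih.comp (measurable_subtreeDeg i))
    exact (measurable_of_countable (loopCost i)).comp (measurable_pi_apply _)

theorem measurable_ballVolume (R : ℕ) : Measurable fun d => ballVolume d R := by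
  simp only [ballVolume_eq_tsum]
  refine Measurable.tsum fun v => ?_
  have h : MeasurableSet {d : List ℕ → ℕ | v ∈ loopBall d R} := by
    simp only [loopBall_eq]
    exact (measurableSet_mem_treeVerts v).inter
      (measurableSet_lt (measurable_loopDepth v) measurable_const)
  have h2 : (fun d => (loopBall d R).indicator (1 : List ℕ → ℝ≥0∞) v)
      = {d : List ℕ → ℕ | v ∈ loopBall d R}.indicator 1 := by
    classical
    funext d
    rw [Set.indicator_apply, Set.indicator_apply]
    rfl
  rw [h2]
  exact measurable_one.indicator h

/-! ### Infinite products of a probability measure -/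

theorem infinitePi_map_comp {ι κ X : Type*} [MeasurableSpace X] (μ : Measure X)
    [IsProbabilityMeasure μ] {e : κ → ι} (he : Function.Injective e) :
    (Measure.infinitePi fun _ : ι => μ).map (fun x k => x (e k)) =
      Measure.infinitePi fun _ : κ => μ := by
  classical
  apply Measure.eq_infinitePi
  intro s t ht
  have hm : Measurable fun (x : ι → X) (k : κ) => x (e k) :=
    measurable_pi_lambda _ fun k => measurable_pi_apply _
  have hpre : (fun (x : ι → X) (k : κ) => x (e k)) ⁻¹' Set.pi s t =
      Set.pi (s.map ⟨e, he⟩) (Function.extend e t fun _ => Set.univ) := by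
    ext x
    simp [Set.mem_pi, he.extend_apply]
  rw [Measure.map_apply hm (MeasurableSet.pi s.countable_toSet fun i _ => ht i), hpre,
    Measure.infinitePi_pi, Finset.prod_map]
  · simp [he.extend_apply]
  · simp [he.extend_apply, ht]

theorem prod_infinitePi_map_elim {κ X : Type*} [MeasurableSpace X] (μ : Measure X)
    [IsProbabilityMeasure μ] :
    (μ.prod (Measure.infinitePi fun _ : κ => μ)).map (fun p o => o.elim p.1 p.2) =
      Measure.infinitePi fun _ : Option κ => μ := by
  classical
  apply Measure.eq_infinitePi
  intro s t ht
  have hm : Measurable fun (p : X × (κ → X)) (o : Option κ) => o.elim p.1 p.2 := by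
    refine measurable_pi_lambda _ fun o => ?_
    cases o with
    | none => exact measurable_fst
    | some k => exact (measurable_pi_apply k).comp measurable_snd
  have hpre : (fun (p : X × (κ → X)) (o : Option κ) => o.elim p.1 p.2) ⁻¹' Set.pi s t =
      (if none ∈ s then t none else Set.univ) ×ˢ
        Set.pi (Finset.eraseNone s) fun k => t (some k) := by
    ext ⟨a, x⟩
    simp only [Set.mem_preimage, Set.mem_pi, Finset.mem_coe, Set.mem_prod, Finset.mem_eraseNone,
      Option.forall, Option.elim]
    split_ifs with h <;> simp [h]
  have hprod : ∏ o ∈ s, μ (t o) =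
      μ (if none ∈ s then t none else Set.univ) * ∏ k ∈ Finset.eraseNone s, μ (t (some k)) := by
    by_cases h : none ∈ s
    · rw [if_pos h, ← Finset.prod_insertNone (fun o => μ (t o)) (Finset.eraseNone s),
        Finset.insertNone_eraseNone, Finset.insert_eq_of_mem h]
    · rw [if_neg h, measure_univ, one_mul]
      conv_lhs => rw [← Finset.erase_eq_of_notMem h, ← Finset.map_some_eraseNone s]
      rw [Finset.prod_map]
      rfl
  rw [Measure.map_apply hm (MeasurableSet.pi s.countable_toSet fun i _ => ht i), hpre,
    Measure.prod_prod, Measure.infinitePi_pi _ (fun i _ => ht _), hprod]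

/-- Under an infinite product measure, a coordinate `i₀` is independent of the family of
coordinates indexed by an injection `e` that avoids `i₀`, and that family is again distributed as
an infinite product. -/
theorem infinitePi_map_prodMk {ι κ X : Type*} [MeasurableSpace X] (μ : Measure X)
    [IsProbabilityMeasure μ] {e : κ → ι} (he : Function.Injective e) {i₀ : ι}
    (hi : ∀ k, e k ≠ i₀) :
    (Measure.infinitePi fun _ : ι => μ).map (fun x => (x i₀, fun k => x (e k))) =
      μ.prod (Measure.infinitePi fun _ : κ => μ) := by
  have he' : Function.Injective fun o : Option κ => o.elim i₀ e := by
    rintro (_ | a) (_ | b) h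
    · rfl
    · exact absurd h.symm (hi b)
    · exact absurd h (hi a)
    · exact congrArg some (he h)
  have hm : Measurable fun (p : X × (κ → X)) (o : Option κ) => o.elim p.1 p.2 := by
    refine measurable_pi_lambda _ fun o => ?_
    cases o with
    | none => exact measurable_fst
    | some k => exact (measurable_pi_apply k).comp measurable_snd
  have hm2 : Measurable fun x : Option κ → X => (x none, fun k => x (some k)) :=
    (measurable_pi_apply _).prodMk (measurable_pi_lambda _ fun k => measurable_pi_apply _)
  have hm3 : Measurable fun (x : ι → X) (o : Option κ) => x (o.elim i₀ e) :=
    measurable_pi_lambda _ fun k => measurable_pi_apply _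
  have h1 := congrArg (Measure.map fun x : Option κ → X => (x none, fun k => x (some k)))
    ((infinitePi_map_comp μ he').trans (prod_infinitePi_map_elim (κ := κ) μ).symm)
  rw [Measure.map_map hm2 hm3, Measure.map_map hm2 hm] at h1
  exact h1.trans Measure.map_id

/-! ### Recursions for the expected volumes -/

/-- The expected volume of a ball in the looptree of the Galton–Watson tree in which all vertices
are normal. -/
def gwVolume (π : PMF ℕ) (R : ℕ) : ℝ≥0∞ :=
  ∫⁻ d, ballVolume d R ∂(Measure.infinitePi fun _ : List ℕ => π.toMeasure)

/-- The expectation of the sum of `F i k` over the children `i < k` of a normal vertex, where `k`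
is their number.  It is also the expectation of `F` for the special child of a special vertex. -/
def childSum (π : PMF ℕ) (F : ℕ → ℕ → ℝ≥0∞) : ℝ≥0∞ :=
  ∑' k, π k * ∑ i ∈ Finset.range k, F i k

theorem lintegral_toMeasure {β : Type*} [MeasurableSpace β] [Countable β]
    [MeasurableSingletonClass β] (p : PMF β) (F : β → ℝ≥0∞) :
    ∫⁻ b, F b ∂p.toMeasure = ∑' b, p b * F b := by
  rw [lintegral_countable']
  refine tsum_congr fun b => ?_
  rw [PMF.toMeasure_apply_singleton _ _ (measurableSet_singleton b), mul_comm]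

theorem sum_range_eq_tsum (F : ℕ → ℝ≥0∞) (k : ℕ) :
    ∑ i ∈ Finset.range k, F i = ∑' i, if i < k then F i else 0 := by
  rw [tsum_eq_sum (s := Finset.range k)]
  · exact Finset.sum_congr rfl fun i hi => by rw [if_pos (Finset.mem_range.1 hi)]
  · intro i hi
    rw [if_neg fun h => hi (Finset.mem_range.2 h)]

theorem childSum_eq_tsum (π : PMF ℕ) (F : ℕ → ℕ → ℝ≥0∞) :
    childSum π F = ∑' i, ∑' k, π k * if i < k then F i k else 0 := by
  rw [ENNReal.tsum_comm, childSum]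
  refine tsum_congr fun k => ?_
  rw [sum_range_eq_tsum, ENNReal.tsum_mul_left]

/-- The number of children of the root is independent of the subtree of child `i`, which has the
law of the whole tree. -/
theorem lintegral_root_subtree (π : PMF ℕ) (i : ℕ) {G : ℕ × (List ℕ → ℕ) → ℝ≥0∞}
    (hG : Measurable G) :
    ∫⁻ d, G (d [], subtreeDeg d i) ∂(Measure.infinitePi fun _ : List ℕ => π.toMeasure) =
      ∑' k, π k * ∫⁻ d, G (k, d) ∂(Measure.infinitePi fun _ : List ℕ => π.toMeasure) := by
  have hm : Measurable fun d : List ℕ → ℕ => (d [], subtreeDeg d i) :=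
    (measurable_pi_apply _).prodMk (measurable_subtreeDeg i)
  have h := infinitePi_map_prodMk π.toMeasure (e := fun w : List ℕ => i :: w)
    (List.cons_injective) (i₀ := []) (fun k => List.cons_ne_nil _ _)
  have h' : (Measure.infinitePi fun _ : List ℕ => π.toMeasure).map
      (fun d => (d [], subtreeDeg d i)) =
      π.toMeasure.prod (Measure.infinitePi fun _ : List ℕ => π.toMeasure) := h
  rw [← lintegral_map hG hm, h', lintegral_prod _ hG.aemeasurable, lintegral_toMeasure]

theorem measurable_ballVolume_child (R i : ℕ) :
    Measurable fun p : ℕ × (List ℕ → ℕ) =>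
      if i < p.1 then ballVolume p.2 (R - loopCost i p.1) else 0 :=
  measurable_from_prod_countable_right fun k => by
    by_cases h : i < k
    · simpa [h] using measurable_ballVolume (R - loopCost i k)
    · simp [h]

/-- The renewal equation of the ordinary Galton–Watson looptree. -/
theorem gwVolume_eq (π : PMF ℕ) (R : ℕ) :
    gwVolume π R = (if 0 < R then 1 else 0) +
      childSum π fun i k => gwVolume π (R - loopCost i k) := by
  have h1 : ∀ d : List ℕ → ℕ, ballVolume d R = (if 0 < R then 1 else 0) + ∑' i,
      (fun p : ℕ × (List ℕ → ℕ) => if i < p.1 then ballVolume p.2 (R - loopCost i p.1) else 0)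
        (d [], subtreeDeg d i) := fun d => by
    rw [ballVolume_eq, sum_range_eq_tsum]
  have hm : ∀ i, Measurable fun d : List ℕ → ℕ =>
      (fun p : ℕ × (List ℕ → ℕ) => if i < p.1 then ballVolume p.2 (R - loopCost i p.1) else 0)
        (d [], subtreeDeg d i) := fun i =>
    (measurable_ballVolume_child R i).comp
      ((measurable_pi_apply _).prodMk (measurable_subtreeDeg i))
  rw [gwVolume, lintegral_congr h1, lintegral_add_left measurable_const, lintegral_const,
    measure_univ, mul_one, lintegral_tsum fun i => (hm i).aemeasurable, childSum_eq_tsum]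
  congr 1
  refine tsum_congr fun i => ?_
  rw [lintegral_root_subtree π i (measurable_ballVolume_child R i)]
  refine tsum_congr fun k => ?_
  by_cases h : i < k
  · simp only [h, if_true]
    rfl
  · simp [h]

theorem tsum_map_mul {β γ : Type*} (p : PMF β) (f : β → γ) (F : γ → ℝ≥0∞) :
    ∑' c, p.map f c * F c = ∑' b, p b * F (f b) := by
  classical
  simp only [PMF.map_apply, ← ENNReal.tsum_mul_right]
  rw [ENNReal.tsum_comm]
  refine tsum_congr fun b => ?_
  rw [tsum_eq_single (f b)]
  · simp
  · intro c hc
    simp [hc]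

/-- The size-biasing factor `k` cancels the probability `1 / k` of each position. -/
theorem tsum_spineStep (π : PMF ℕ) (h : IsCritical π) (F : ℕ × ℕ → ℝ≥0∞) :
    ∑' p, spineStep π h p * F p = childSum π fun i k => F (k, i) := by
  simp only [spineStep, PMF.bind_apply, ← ENNReal.tsum_mul_right]
  rw [ENNReal.tsum_comm, childSum]
  refine tsum_congr fun k => ?_
  simp only [mul_assoc, ENNReal.tsum_mul_left]
  have hk : sizeBiased π h k = (k : ℝ≥0∞) * π k := rfl
  rw [hk]
  cases k with
  | zero => simp
  | succ k =>
    rw [chooseSpecial, tsum_map_mul, tsum_fintype, mul_comm (_ : ℝ≥0∞) (π _), mul_assoc,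
      Finset.sum_range]
    congr 1
    simp only [PMF.uniformOfFintype_apply, Fintype.card_fin, ← Finset.mul_sum]
    rw [← mul_assoc, ENNReal.mul_inv_cancel (by simp) (by simp), one_mul]

/-- The sample of the tree grown from child number `i` of the root, if that child is special. -/
def subtreeSample (ω : Sample) (i : ℕ) : Sample := (subtreeDeg ω.1 i, fun n => ω.2 (n + 1))

theorem spine_succ (ω : Sample) (i n : ℕ) :
    spine ω (n + 1) = (ω.2 0).2 :: spine (subtreeSample ω i) n := by
  simp [spine, subtreeSample, List.range_succ_eq_map, Function.comp_def]

theorem subtreeDeg_modifiedOutdeg (ω : Sample) (i : ℕ) :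
    subtreeDeg (modifiedOutdeg ω) i =
      if i = (ω.2 0).2 then modifiedOutdeg (subtreeSample ω i) else subtreeDeg ω.1 i := by
  funext w
  split_ifs with h
  · simp only [subtreeDeg, modifiedOutdeg, List.length_cons, spine_succ ω i, h, List.cons.injEq,
      true_and]
    rfl
  · simp only [subtreeDeg, modifiedOutdeg, List.length_cons, spine_succ ω i, h, List.cons.injEq,
      false_and, if_false]

theorem modifiedOutdeg_nil (ω : Sample) : modifiedOutdeg ω [] = (ω.2 0).1 := by
  simp [modifiedOutdeg, spine]

theorem measurable_modifiedOutdeg : Measurable modifiedOutdeg := by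
  refine measurable_pi_lambda _ fun u => ?_
  have h2 : ∀ n, Measurable fun ω : Sample => ω.2 n := fun n =>
    (measurable_pi_apply n).comp measurable_snd
  refine Measurable.ite ?_ (measurable_fst.comp (h2 _))
    ((measurable_pi_apply u).comp measurable_fst)
  have : {ω : Sample | u = spine ω u.length} =
      ⋂ i : Fin u.length, {ω : Sample | u[i] = (ω.2 i).2} := by
    ext ω
    simp only [Set.mem_ofPred_eq, Set.mem_iInter]
    constructor
    · intro h i
      conv_lhs => rw [Fin.getElem_fin, List.getElem_of_eq h]
      simp [spine]
    · intro h
      refine List.ext_getElem (by simp [spine]) fun i hi _ => ?_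
      simpa [spine] using h ⟨i, hi⟩
  rw [this]
  exact MeasurableSet.iInter fun i =>
    measurableSet_eq_fun measurable_const (measurable_snd.comp (h2 i))

theorem measurable_step_subtreeSample (i : ℕ) :
    Measurable fun ω : Sample => (ω.2 0, subtreeSample ω i) :=
  Measurable.prodMk ((measurable_pi_apply _).comp measurable_snd)
    (((measurable_subtreeDeg i).comp measurable_fst).prodMk
      (measurable_pi_lambda _ fun _ => (measurable_pi_apply _).comp measurable_snd))

/-- The first step of the spine is independent of the randomness of the subtree of child `i`,
which has the law of the whole sample. -/
theorem lintegral_step_subtreeSample (π : PMF ℕ) (h : IsCritical π) (i : ℕ)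
    {G : (ℕ × ℕ) × Sample → ℝ≥0∞} (hG : Measurable G) :
    ∫⁻ ω, G (ω.2 0, subtreeSample ω i) ∂(sampleLaw π h) =
      ∑' p, spineStep π h p * ∫⁻ ω, G (p, ω) ∂(sampleLaw π h) := by
  set μ := Measure.infinitePi fun _ : List ℕ => π.toMeasure with hμ
  set ν := Measure.infinitePi fun _ : ℕ => (spineStep π h).toMeasure with hν
  have hmap : μ.map (fun d => subtreeDeg d i) = μ :=
    infinitePi_map_comp π.toMeasure (e := fun w : List ℕ => i :: w) List.cons_injective
  have hmap2 : ν.map (fun y => (y 0, fun n => y (n + 1))) = (spineStep π h).toMeasure.prod ν :=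
    infinitePi_map_prodMk (spineStep π h).toMeasure (e := Nat.succ) Nat.succ_injective
      (i₀ := 0) Nat.succ_ne_zero
  have hm2 : Measurable fun y : ℕ → ℕ × ℕ => (y 0, fun n => y (n + 1)) :=
    (measurable_pi_apply _).prodMk (measurable_pi_lambda _ fun n => measurable_pi_apply _)
  have hG2 : ∀ x, Measurable fun q : (ℕ × ℕ) × (ℕ → ℕ × ℕ) => G (q.1, (x, q.2)) := fun x =>
    hG.comp (measurable_fst.prodMk (measurable_const.prodMk measurable_snd))
  have hG3 : Measurable fun q : (List ℕ → ℕ) × (ℕ × ℕ) × (ℕ → ℕ × ℕ) =>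
      G (q.2.1, (q.1, q.2.2)) :=
    hG.comp ((measurable_fst.comp measurable_snd).prodMk
      (measurable_fst.prodMk (measurable_snd.comp measurable_snd)))
  have hG4 : ∀ p, Measurable fun ω : Sample => G (p, ω) := fun p =>
    hG.comp (measurable_const.prodMk measurable_id)
  calc ∫⁻ ω, G (ω.2 0, subtreeSample ω i) ∂(μ.prod ν)
      = ∫⁻ x, ∫⁻ y, G (y 0, (subtreeDeg x i, fun n => y (n + 1))) ∂ν ∂μ :=
        lintegral_prod _ (hG.comp (measurable_step_subtreeSample i)).aemeasurable
    _ = ∫⁻ x, ∫⁻ q, G (q.1, (subtreeDeg x i, q.2)) ∂((spineStep π h).toMeasure.prod ν) ∂μ := by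
        refine lintegral_congr fun x => ?_
        rw [← hmap2, lintegral_map (hG2 _) hm2]
    _ = ∫⁻ x, ∫⁻ q, G (q.1, (x, q.2)) ∂((spineStep π h).toMeasure.prod ν) ∂μ := by
        conv_rhs => rw [← hmap]
        rw [lintegral_map hG3.lintegral_prod_right' (measurable_subtreeDeg i)]
    _ = ∫⁻ x, ∑' p, spineStep π h p * ∫⁻ y, G (p, (x, y)) ∂ν ∂μ := by
        refine lintegral_congr fun x => ?_
        rw [lintegral_prod _ (hG2 x).aemeasurable, lintegral_toMeasure]
    _ = ∑' p, spineStep π h p * ∫⁻ ω, G (p, ω) ∂(μ.prod ν) := by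
        rw [lintegral_tsum fun p => ((hG4 p).lintegral_prod_right'.const_mul _).aemeasurable]
        refine tsum_congr fun p => ?_
        rw [lintegral_const_mul _ (hG4 p).lintegral_prod_right',
          lintegral_prod _ (hG4 p).aemeasurable]

/-- The expected number of vertices within distance less than `R` of a special vertex, among
this vertex and the descendants of its normal children. -/
def bushVolume (π : PMF ℕ) (R : ℕ) : ℝ≥0∞ :=
  (if 0 < R then 1 else 0) + childSum π fun j k =>
    ∑ i ∈ (Finset.range k).erase j, gwVolume π (R - loopCost i k)

/-- The renewal equation along the spine: the subtree of the special child of the root has again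
the law of the modified tree, the subtrees of the other children are ordinary Galton–Watson
trees. -/
theorem expectedVolume_eq (π : PMF ℕ) (h : IsCritical π) (R : ℕ) :
    expectedVolume π h R = bushVolume π R +
      childSum π fun j k => expectedVolume π h (R - loopCost j k) := by
  -- The contribution of child `i`, given the first step of the spine.
  let G : ℕ → (ℕ × ℕ) × Sample → ℝ≥0∞ := fun i q =>
    if i < q.1.1 then
      if i = q.1.2 then ballVolume (modifiedOutdeg q.2) (R - loopCost i q.1.1)
      else ballVolume q.2.1 (R - loopCost i q.1.1)
    else 0
  have hG : ∀ i, Measurable (G i) := fun i => measurable_from_prod_countable_right fun p => by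
    by_cases h1 : i < p.1
    · by_cases h2 : i = p.2
      · simp only [G, if_pos h1, if_pos h2]
        exact (measurable_ballVolume (R - loopCost i p.1)).comp measurable_modifiedOutdeg
      · simp only [G, if_pos h1, if_neg h2]
        exact (measurable_ballVolume (R - loopCost i p.1)).comp measurable_fst
    · simpa only [G, if_neg h1] using measurable_const
  have h1 : ∀ ω : Sample, ((loopBall (modifiedOutdeg ω) R).encard : ℝ≥0∞) =
      (if 0 < R then 1 else 0) + ∑' i, G i (ω.2 0, subtreeSample ω i) := fun ω => by
    have := ballVolume_eq (modifiedOutdeg ω) R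
    rw [ballVolume, sum_range_eq_tsum, modifiedOutdeg_nil] at this
    rw [this]
    congr 1
    refine tsum_congr fun i => ?_
    simp only [G, subtreeDeg_modifiedOutdeg]
    split_ifs <;> rfl
  have hm : ∀ i, Measurable fun ω : Sample => G i (ω.2 0, subtreeSample ω i) := fun i =>
    (hG i).comp (measurable_step_subtreeSample i)
  have hprob : IsProbabilityMeasure (sampleLaw π h) := by
    unfold sampleLaw; infer_instance
  have hI : ∀ i p, ∫⁻ ω, G i (p, ω) ∂(sampleLaw π h) =
      if i < p.1 then
        if i = p.2 then expectedVolume π h (R - loopCost i p.1)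
        else gwVolume π (R - loopCost i p.1)
      else 0 := fun i p => by
    by_cases h1 : i < p.1
    · by_cases h2 : i = p.2
      · simp only [G, if_pos h1, if_pos h2]
        rfl
      · simp only [G, if_pos h1, if_neg h2]
        have hb : Measurable fun ω : Sample => ballVolume ω.1 (R - loopCost i p.1) :=
          (measurable_ballVolume _).comp measurable_fst
        rw [sampleLaw, lintegral_prod _ hb.aemeasurable]
        simp [gwVolume]
    · simp [G, if_neg h1]
  rw [expectedVolume, lintegral_congr h1, lintegral_add_left measurable_const, lintegral_const,
    measure_univ, mul_one, lintegral_tsum fun i => (hm i).aemeasurable,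
    bushVolume, add_assoc]
  congr 1
  calc ∑' i, ∫⁻ ω, G i (ω.2 0, subtreeSample ω i) ∂(sampleLaw π h)
      = ∑' i, ∑' p, spineStep π h p * ∫⁻ ω, G i (p, ω) ∂(sampleLaw π h) :=
        tsum_congr fun i => lintegral_step_subtreeSample π h i (hG i)
    _ = childSum π fun j k => ∑ i ∈ Finset.range k,
          if i = j then expectedVolume π h (R - loopCost i k)
          else gwVolume π (R - loopCost i k) := by
        rw [ENNReal.tsum_comm, ← tsum_spineStep π h fun p => ∑ i ∈ Finset.range p.1,
          if i = p.2 then expectedVolume π h (R - loopCost i p.1)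
          else gwVolume π (R - loopCost i p.1)]
        refine tsum_congr fun p => ?_
        simp only [hI]
        rw [ENNReal.tsum_mul_left, sum_range_eq_tsum]
    _ = _ := by
        rw [childSum, childSum, childSum, ← ENNReal.tsum_add]
        refine tsum_congr fun k => ?_
        rw [← mul_add, ← Finset.sum_add_distrib]
        congr 1
        refine Finset.sum_congr rfl fun j hj => ?_
        rw [← Finset.add_sum_erase _ _ hj, if_pos rfl, add_comm]
        congr 1
        exact Finset.sum_congr rfl fun i hi => if_neg (Finset.ne_of_mem_erase hi)

/-! ### Sums over the children of a vertex -/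

theorem childSum_mono (π : PMF ℕ) {F G : ℕ → ℕ → ℝ≥0∞} (h : ∀ k i, i < k → F i k ≤ G i k) :
    childSum π F ≤ childSum π G :=
  ENNReal.tsum_le_tsum fun k => mul_le_mul_right
    (Finset.sum_le_sum fun i hi => h k i (Finset.mem_range.1 hi)) _

theorem childSum_add (π : PMF ℕ) (F G : ℕ → ℕ → ℝ≥0∞) :
    childSum π F + childSum π G = childSum π fun i k => F i k + G i k := by
  simp only [childSum, ← ENNReal.tsum_add, Finset.sum_add_distrib, mul_add]

theorem childSum_mul (π : PMF ℕ) (F : ℕ → ℕ → ℝ≥0∞) (a : ℝ≥0∞) :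
    childSum π F * a = childSum π fun i k => F i k * a := by
  simp only [childSum, ← ENNReal.tsum_mul_right, Finset.sum_mul, mul_assoc]

theorem mul_childSum (π : PMF ℕ) (F : ℕ → ℕ → ℝ≥0∞) (a : ℝ≥0∞) :
    a * childSum π F = childSum π fun i k => a * F i k := by
  simp only [mul_comm a, childSum_mul]

theorem childSum_const {π : PMF ℕ} (h : IsCritical π) (a : ℝ≥0∞) :
    childSum π (fun _ _ => a) = a := by
  have h1 : childSum π (fun _ _ => a) = (∑' k : ℕ, (k : ℝ≥0∞) * π k) * a := by
    rw [childSum, ← ENNReal.tsum_mul_right]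
    refine tsum_congr fun k => ?_
    rw [Finset.sum_const, Finset.card_range, nsmul_eq_mul]
    ring
  rw [h1, show ∑' k : ℕ, (k : ℝ≥0∞) * π k = 1 from h, one_mul]

theorem loopCost_pos {i k : ℕ} (h : i < k) : 0 < loopCost i k := by
  simp only [loopCost]
  omega

/-- The truncated mean of the distance between consecutive vertices of the spine. -/
def meanCost (π : PMF ℕ) (n : ℕ) : ℝ≥0∞ :=
  childSum π fun i k => ((min (loopCost i k) n : ℕ) : ℝ≥0∞)

/-- The truncated mean of the size-biased distribution, `∑ k, k π_k min (k, n)`. -/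
def meanSize (π : PMF ℕ) (n : ℕ) : ℝ≥0∞ :=
  childSum π fun _ k => ((min k n : ℕ) : ℝ≥0∞)

theorem meanSize_eq_tsum (π : PMF ℕ) (n : ℕ) :
    meanSize π n = ∑' k, π k * ((k * min k n : ℕ) : ℝ≥0∞) := by
  rw [meanSize, childSum]
  refine tsum_congr fun k => ?_
  rw [Finset.sum_const, Finset.card_range, nsmul_eq_mul, Nat.cast_mul]

theorem meanSize_mono (π : PMF ℕ) {m n : ℕ} (h : m ≤ n) : meanSize π m ≤ meanSize π n :=
  childSum_mono π fun k i _ => by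
    exact_mod_cast min_le_min le_rfl h

theorem meanSize_le {π : PMF ℕ} (h : IsCritical π) (n : ℕ) : meanSize π n ≤ n := by
  rw [← childSum_const h n]
  exact childSum_mono π fun k i _ => by exact_mod_cast min_le_right _ _

theorem one_le_meanSize {π : PMF ℕ} (h : IsCritical π) {n : ℕ} (hn : 1 ≤ n) :
    1 ≤ meanSize π n := by
  rw [← childSum_const h 1]
  exact childSum_mono π fun k i hi => by
    have : 1 ≤ min k n := le_min (by omega) hn
    exact_mod_cast this

theorem meanCost_le_meanSize (π : PMF ℕ) (n : ℕ) : meanCost π n ≤ meanSize π n :=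
  childSum_mono π fun k i hi => by
    have : min (loopCost i k) n ≤ min k n := by
      simp only [loopCost]
      omega
    exact_mod_cast this

/-- The summands `i` and `m - 1 - i` are paired. -/
theorem mul_min_le_two_mul_sum (m n : ℕ) :
    m * min (m + 1) n ≤ 2 * ∑ i ∈ Finset.range m, min (i + 1) n := by
  rw [two_mul]
  nth_rewrite 2 [← Finset.sum_range_reflect]
  rw [← Finset.sum_add_distrib]
  calc m * min (m + 1) n = ∑ _i ∈ Finset.range m, min (m + 1) n := by simp
    _ ≤ _ := Finset.sum_le_sum fun i hi => by
      rw [Finset.mem_range] at hi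
      omega

theorem mul_min_le_eight_mul_sum (k n : ℕ) :
    k * min k n ≤ 8 * ∑ i ∈ Finset.range k, min (loopCost i k) n := by
  -- Only the left half of the loop is used, on which the distance is `i + 1`.
  obtain ⟨m, hm1, hm2, hm3⟩ : ∃ m, k ≤ 2 * m ∧ 2 * m ≤ k + 1 ∧ m ≤ k :=
    ⟨(k + 1) / 2, by omega, by omega, by omega⟩
  have h1 := mul_min_le_two_mul_sum m n
  have h2 : ∑ i ∈ Finset.range m, min (i + 1) n ≤
      ∑ i ∈ Finset.range k, min (loopCost i k) n := by
    refine le_trans (Finset.sum_le_sum fun i hi => ?_)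
      (Finset.sum_le_sum_of_subset (Finset.range_mono hm3))
    rw [Finset.mem_range] at hi
    simp only [loopCost]
    omega
  have h3 : k * min k n ≤ (2 * m) * (2 * min (m + 1) n) := Nat.mul_le_mul hm1 (by omega)
  have h4 : (2 * m) * (2 * min (m + 1) n) = 4 * (m * min (m + 1) n) := by ring
  omega

theorem meanSize_le_meanCost (π : PMF ℕ) (n : ℕ) : meanSize π n ≤ 8 * meanCost π n := by
  rw [meanSize_eq_tsum, meanCost, childSum, ← ENNReal.tsum_mul_left]
  refine ENNReal.tsum_le_tsum fun k => ?_
  rw [mul_left_comm]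
  refine mul_le_mul_right ?_ _
  exact_mod_cast mul_min_le_eight_mul_sum k n

/-! ### Renewal estimates -/

theorem ballVolume_zero (d : List ℕ → ℕ) : ballVolume d 0 = 0 := by
  simp [ballVolume, loopBall]

theorem ballVolume_mono (d : List ℕ → ℕ) {R S : ℕ} (h : R ≤ S) :
    ballVolume d R ≤ ballVolume d S :=
  ENat.toENNReal_mono (Set.encard_le_encard (loopBall_mono d h))

theorem gwVolume_zero (π : PMF ℕ) : gwVolume π 0 = 0 := by
  simp [gwVolume, ballVolume_zero]

theorem gwVolume_mono (π : PMF ℕ) {R S : ℕ} (h : R ≤ S) : gwVolume π R ≤ gwVolume π S :=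
  lintegral_mono fun d => ballVolume_mono d h

theorem expectedVolume_zero (π : PMF ℕ) (h : IsCritical π) : expectedVolume π h 0 = 0 := by
  simp [expectedVolume, loopBall]

theorem expectedVolume_mono (π : PMF ℕ) (h : IsCritical π) {R S : ℕ} (hRS : R ≤ S) :
    expectedVolume π h R ≤ expectedVolume π h S :=
  lintegral_mono fun _ => ballVolume_mono _ hRS

theorem bushVolume_mono (π : PMF ℕ) {R S : ℕ} (h : R ≤ S) :
    bushVolume π R ≤ bushVolume π S := by
  refine add_le_add ?_ (childSum_mono π fun k j _ => Finset.sum_le_sum fun i _ =>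
    gwVolume_mono π (Nat.sub_le_sub_right h _))
  split_ifs with h1 h2
  · exact le_rfl
  · omega
  · exact zero_le
  · exact le_rfl

theorem one_le_bushVolume (π : PMF ℕ) {R : ℕ} (h : 1 ≤ R) : 1 ≤ bushVolume π R := by
  rw [bushVolume, if_pos (by omega)]
  exact le_self_add

/-- Lower renewal bound: `gwVolume π R` is the mean number of steps that a random walk with steps
distributed as `loopCost` needs to reach `R`, and the truncated steps of that walk add up to at
least `R`. -/
theorem le_gwVolume_mul_meanCost {π : PMF ℕ} (h : IsCritical π) (n : ℕ) :
    ∀ R ≤ n, (R : ℝ≥0∞) ≤ gwVolume π R * meanCost π n := by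
  intro R
  induction R using Nat.strong_induction_on with
  | _ R ih =>
  intro hR
  rcases Nat.eq_zero_or_pos R with rfl | hpos
  · simp
  rw [gwVolume_eq, if_pos hpos, add_mul, one_mul, childSum_mul, meanCost, childSum_add]
  rw [← meanCost]
  calc (R : ℝ≥0∞) = childSum π fun _ _ => (R : ℝ≥0∞) := (childSum_const h _).symm
    _ ≤ _ := childSum_mono π fun k i hi => by
      have hc := loopCost_pos hi
      refine le_trans ?_ (add_le_add le_rfl (ih (R - loopCost i k) (by omega) (by omega)))
      have : R ≤ min (loopCost i k) n + (R - loopCost i k) := by omega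
      exact_mod_cast this

/-- Upper renewal bound: the truncated steps overshoot `R` by at most `n`. -/
theorem gwVolume_mul_meanCost_le {π : PMF ℕ} (h : IsCritical π) (n : ℕ) :
    ∀ R, gwVolume π R * meanCost π n ≤ ((R + n : ℕ) : ℝ≥0∞) := by
  intro R
  induction R using Nat.strong_induction_on with
  | _ R ih =>
  rcases Nat.eq_zero_or_pos R with rfl | hpos
  · simp [gwVolume_zero]
  rw [gwVolume_eq, if_pos hpos, add_mul, one_mul, childSum_mul, meanCost, childSum_add]
  rw [← meanCost]
  calc _ ≤ childSum π fun _ _ => ((R + n : ℕ) : ℝ≥0∞) := childSum_mono π fun k i hi => by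
        have hc := loopCost_pos hi
        rcases Nat.lt_or_ge (loopCost i k) R with hlt | hge
        · refine (add_le_add le_rfl (ih (R - loopCost i k) (by omega))).trans ?_
          have : min (loopCost i k) n + (R - loopCost i k + n) ≤ R + n := by omega
          exact_mod_cast this
        · rw [Nat.sub_eq_zero_of_le hge, gwVolume_zero, zero_mul, add_zero]
          have : min (loopCost i k) n ≤ R + n := by omega
          exact_mod_cast this
    _ = _ := childSum_const h _

/-- The renewal equation of `expectedVolume` is dominated by that of `gwVolume`, multiplied by
the largest value of the inhomogeneous term. -/
theorem expectedVolume_le {π : PMF ℕ} (h : IsCritical π) (n : ℕ) :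
    ∀ R ≤ n, expectedVolume π h R ≤ bushVolume π n * gwVolume π R := by
  intro R
  induction R using Nat.strong_induction_on with
  | _ R ih =>
  intro hR
  rcases Nat.eq_zero_or_pos R with rfl | hpos
  · simp [expectedVolume_zero]
  rw [expectedVolume_eq, gwVolume_eq, if_pos hpos, mul_add, mul_one, mul_childSum]
  refine add_le_add (bushVolume_mono π hR) (childSum_mono π fun k i hi => ?_)
  have hc := loopCost_pos hi
  exact ih _ (by omega) (by omega)

/-- As long as the walk along the spine has not reached `R`, there is room for a ball of radius
`S` around its position. -/
theorem bushVolume_mul_le_expectedVolume {π : PMF ℕ} (h : IsCritical π) (S : ℕ) :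
    ∀ R, bushVolume π S * gwVolume π R ≤ expectedVolume π h (R + S) := by
  intro R
  induction R using Nat.strong_induction_on with
  | _ R ih =>
  rcases Nat.eq_zero_or_pos R with rfl | hpos
  · simp [gwVolume_zero]
  rw [expectedVolume_eq, gwVolume_eq, if_pos hpos, mul_add, mul_one, mul_childSum]
  refine add_le_add (bushVolume_mono π (by omega)) (childSum_mono π fun k i hi => ?_)
  have hc := loopCost_pos hi
  rcases Nat.lt_or_ge (loopCost i k) R with hlt | hge
  · rw [show R + S - loopCost i k = R - loopCost i k + S by omega]
    exact ih _ (by omega)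
  · rw [Nat.sub_eq_zero_of_le hge, gwVolume_zero, mul_zero]
    exact zero_le

theorem card_loopCost_lt_le (k n : ℕ) :
    ((Finset.range k).filter fun i => loopCost i k < n).card ≤ 2 * min k n := by
  have h1 : ((Finset.range k).filter fun i => loopCost i k < n) ⊆
      Finset.range (min k n) ∪ Finset.Ico (k - min k n) k := by
    intro i hi
    obtain ⟨hi1, hi2⟩ := Finset.mem_filter.1 hi
    simp only [Finset.mem_range, Finset.mem_union, Finset.mem_Ico, loopCost] at hi1 hi2 ⊢
    omega
  refine (Finset.card_le_card h1).trans ((Finset.card_union_le _ _).trans ?_)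
  rw [Finset.card_range, Nat.card_Ico]
  omega

/-- At most `2 min (k, n)` children of a vertex with `k` children are within distance less than
`n`. -/
theorem bushVolume_le (π : PMF ℕ) (n : ℕ) :
    bushVolume π n ≤ 1 + 2 * (gwVolume π n * meanSize π n) := by
  refine add_le_add (by split_ifs <;> simp) ?_
  rw [meanSize, ← mul_assoc, mul_childSum]
  refine childSum_mono π fun k j _ => ?_
  calc ∑ i ∈ (Finset.range k).erase j, gwVolume π (n - loopCost i k)
      ≤ ∑ i ∈ Finset.range k, gwVolume π (n - loopCost i k) :=
        Finset.sum_le_sum_of_subset (Finset.erase_subset _ _)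
    _ ≤ ∑ i ∈ Finset.range k, if loopCost i k < n then gwVolume π n else 0 :=
        Finset.sum_le_sum fun i _ => by
          split_ifs with hlt
          · exact gwVolume_mono π (Nat.sub_le _ _)
          · rw [Nat.sub_eq_zero_of_le (not_lt.1 hlt), gwVolume_zero]
    _ = (((Finset.range k).filter fun i => loopCost i k < n).card : ℝ≥0∞) * gwVolume π n := by
        rw [← Finset.sum_filter, Finset.sum_const, nsmul_eq_mul]
    _ ≤ ((2 * min k n : ℕ) : ℝ≥0∞) * gwVolume π n := by
        refine mul_le_mul_left ?_ _
        exact_mod_cast card_loopCost_lt_le k n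
    _ = _ := by push_cast; ring

/-- The contribution of vertices with at least two children to `meanSize`. -/
def meanSizeTwo (π : PMF ℕ) (n : ℕ) : ℝ≥0∞ :=
  childSum π fun _ k => if 2 ≤ k then ((min k n : ℕ) : ℝ≥0∞) else 0

theorem childSum_split {π : PMF ℕ} (F : ℕ → ℝ≥0∞) :
    childSum π (fun _ k => F k) =
      π 1 * F 1 + childSum π fun _ k => if 2 ≤ k then F k else 0 := by
  have h1 : childSum π (fun _ k => if 2 ≤ k then 0 else F k) = π 1 * F 1 := by
    rw [childSum, tsum_eq_single 1]
    · simp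
    · rintro (_ | _ | k) hk
      · simp
      · exact absurd rfl hk
      · simp
  rw [← h1, childSum_add]
  congr 1
  funext i k
  split_ifs <;> simp

/-- Vertices with a single child contribute at most a constant factor to `meanSize`. -/
theorem mul_meanSize_le {π : PMF ℕ} (h : IsCritical π) {n : ℕ} (hn : 1 ≤ n) :
    (1 - π 1) * meanSize π n ≤ meanSizeTwo π n := by
  have h1 : meanSize π n = π 1 + meanSizeTwo π n := by
    rw [meanSize, childSum_split (fun k => ((min k n : ℕ) : ℝ≥0∞)), min_eq_left hn]
    simp [meanSizeTwo]
  have h2 : 1 - π 1 ≤ meanSizeTwo π n := by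
    rw [tsub_le_iff_left]
    conv_lhs => rw [← childSum_const h 1, childSum_split (fun _ => 1), mul_one]
    refine add_le_add le_rfl (childSum_mono π fun k i _ => ?_)
    split_ifs with hk
    · have : 1 ≤ min k n := by omega
      exact_mod_cast this
    · exact le_rfl
  calc (1 - π 1) * meanSize π n = (1 - π 1) * π 1 + (1 - π 1) * meanSizeTwo π n := by
        rw [h1, mul_add]
    _ ≤ meanSizeTwo π n * π 1 + (1 - π 1) * meanSizeTwo π n := by gcongr
    _ = (π 1 + (1 - π 1)) * meanSizeTwo π n := by ring
    _ = meanSizeTwo π n := by rw [add_tsub_cancel_of_le (π.coe_le_one 1), one_mul]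

/-- Each of the first `min k t` children other than the special one is within distance `t`, so a
ball of radius `t` fits above it; at least half of these children are normal, since there are at
least two of them. -/
theorem gwVolume_mul_meanSizeTwo_le (π : PMF ℕ) {t : ℕ} (ht : 2 ≤ t) :
    gwVolume π t * meanSizeTwo π t ≤ 2 * bushVolume π (2 * t) := by
  rw [bushVolume, meanSizeTwo, mul_add, mul_childSum, mul_childSum]
  refine le_trans (childSum_mono π fun k j _ => ?_) le_add_self
  split_ifs with hk
  · have hcard : min k t ≤ 2 * ((Finset.range (min k t)).erase j).card := by
      have := Finset.pred_card_le_card_erase (s := Finset.range (min k t)) (a := j)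
      rw [Finset.card_range] at this
      omega
    calc gwVolume π t * ((min k t : ℕ) : ℝ≥0∞)
        ≤ gwVolume π t * ((2 * ((Finset.range (min k t)).erase j).card : ℕ) : ℝ≥0∞) := by
          refine mul_le_mul_right ?_ _
          exact_mod_cast hcard
      _ = 2 * ∑ i ∈ (Finset.range (min k t)).erase j, gwVolume π t := by
          rw [Finset.sum_const, nsmul_eq_mul]
          push_cast
          ring
      _ ≤ 2 * ∑ i ∈ (Finset.range (min k t)).erase j, gwVolume π (2 * t - loopCost i k) := by
          refine mul_le_mul_right (Finset.sum_le_sum fun i hi => gwVolume_mono π ?_) _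
          have := Finset.mem_range.1 (Finset.mem_of_mem_erase hi)
          simp only [loopCost]
          omega
      _ ≤ _ := by
          refine mul_le_mul_right (Finset.sum_le_sum_of_subset ?_) _
          exact Finset.erase_subset_erase _ (Finset.range_mono (min_le_left _ _))
  · simp

/-- The expected volume is at most of order `n² / meanSize π n`. -/
theorem expectedVolume_mul_meanSize_le {π : PMF ℕ} (h : IsCritical π) {n : ℕ} (hn : 1 ≤ n) :
    expectedVolume π h n * meanSize π n ≤ 528 * (n : ℝ≥0∞) ^ 2 := by
  have h1 : gwVolume π n * meanSize π n ≤ 16 * n := by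
    calc gwVolume π n * meanSize π n ≤ gwVolume π n * (8 * meanCost π n) := by
          gcongr; exact meanSize_le_meanCost π n
      _ = 8 * (gwVolume π n * meanCost π n) := by ring
      _ ≤ 8 * ((n + n : ℕ) : ℝ≥0∞) := by gcongr; exact gwVolume_mul_meanCost_le h n n
      _ = 16 * n := by push_cast; ring
  have hn' : (1 : ℝ≥0∞) ≤ n := by exact_mod_cast hn
  calc expectedVolume π h n * meanSize π n
      ≤ bushVolume π n * gwVolume π n * meanSize π n := by
        gcongr; exact expectedVolume_le h n n le_rfl
    _ ≤ (1 + 2 * (gwVolume π n * meanSize π n)) * gwVolume π n * meanSize π n := by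
        gcongr; exact bushVolume_le π n
    _ = (1 + 2 * (gwVolume π n * meanSize π n)) * (gwVolume π n * meanSize π n) := by ring
    _ ≤ (n + 2 * (16 * n)) * (16 * n) := by gcongr
    _ = 528 * (n : ℝ≥0∞) ^ 2 := by ring

theorem one_le_expectedVolume {π : PMF ℕ} (h : IsCritical π) {n : ℕ} (hn : 1 ≤ n) :
    1 ≤ expectedVolume π h n := by
  rw [expectedVolume_eq]
  exact (one_le_bushVolume π hn).trans le_self_add

/-- The expected volume is at least of order `n² / meanSize π n`. -/
theorem le_expectedVolume_mul_meanSize {π : PMF ℕ} (h : IsCritical π) {n : ℕ} (hn : 1 ≤ n) :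
    (1 - π 1) * (n : ℝ≥0∞) ^ 2 ≤ 128 * (expectedVolume π h n * meanSize π n) := by
  rcases Nat.lt_or_ge n 8 with hlt | hge
  · have h1 : ((n ^ 2 : ℕ) : ℝ≥0∞) ≤ 128 := by
      have : n ^ 2 ≤ 128 := by nlinarith
      exact_mod_cast this
    calc (1 - π 1) * (n : ℝ≥0∞) ^ 2 ≤ 1 * 128 := by
          gcongr
          · exact tsub_le_self
          · exact_mod_cast h1
      _ = 128 * (1 * 1) := by ring
      _ ≤ _ := by gcongr; exacts [one_le_expectedVolume h hn, one_le_meanSize h hn]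
  obtain ⟨t, ht2, htn, hnt⟩ : ∃ t, 2 ≤ t ∧ 4 * t ≤ n ∧ n ≤ 8 * t :=
    ⟨n / 4, by omega, by omega, by omega⟩
  have hw0 : meanSize π t ≠ 0 := (one_pos.trans_le (one_le_meanSize h (by omega))).ne'
  have hwt : meanSize π t ≠ ∞ := ((meanSize_le h t).trans_lt (ENNReal.natCast_lt_top t)).ne
  have h1 : (t : ℝ≥0∞) ≤ gwVolume π t * meanSize π t :=
    (le_gwVolume_mul_meanCost h t t le_rfl).trans
      (mul_le_mul_right (meanCost_le_meanSize π t) _)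
  -- Multiplying by `meanSize π t` allows `h1` to be used twice.
  have h2 : (1 - π 1) * (t : ℝ≥0∞) ^ 2 ≤ 2 * (expectedVolume π h n * meanSize π t) := by
    rw [← ENNReal.mul_le_mul_iff_left hw0 hwt]
    calc (1 - π 1) * (t : ℝ≥0∞) ^ 2 * meanSize π t
        = (1 - π 1) * meanSize π t * (t : ℝ≥0∞) ^ 2 := by ring
      _ ≤ meanSizeTwo π t * (gwVolume π t * meanSize π t) ^ 2 := by
          gcongr; exact mul_meanSize_le h (by omega)
      _ = gwVolume π t * meanSizeTwo π t * gwVolume π t * meanSize π t ^ 2 := by ring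
      _ ≤ 2 * bushVolume π (2 * t) * gwVolume π (2 * t) * meanSize π t ^ 2 := by
          gcongr ?_ * ?_ * _
          · exact gwVolume_mul_meanSizeTwo_le π ht2
          · exact gwVolume_mono π (by omega)
      _ = 2 * (bushVolume π (2 * t) * gwVolume π (2 * t)) * meanSize π t ^ 2 := by ring
      _ ≤ 2 * expectedVolume π h n * meanSize π t ^ 2 := by
          gcongr
          exact (bushVolume_mul_le_expectedVolume h _ _).trans
            (expectedVolume_mono π h (by omega))
      _ = _ := by ring
  calc (1 - π 1) * (n : ℝ≥0∞) ^ 2 ≤ (1 - π 1) * ((8 * t : ℕ) : ℝ≥0∞) ^ 2 := by gcongr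
    _ = 64 * ((1 - π 1) * (t : ℝ≥0∞) ^ 2) := by push_cast; ring
    _ ≤ 64 * (2 * (expectedVolume π h n * meanSize π t)) := by gcongr
    _ = 128 * (expectedVolume π h n * meanSize π t) := by ring
    _ ≤ _ := by gcongr; exact meanSize_mono π (by omega)

/-! ### The generating function near `1` -/

theorem one_sub_pow_le {x : ℝ} (hx0 : 0 ≤ x) (hx1 : x ≤ 1) (k : ℕ) :
    (1 - x) ^ k ≤ 1 - k * x + (k * x) ^ 2 := by
  induction k with
  | zero => simp
  | succ k ih =>
    have h1 : (1 - x) ^ (k + 1) ≤ (1 - k * x + (k * x) ^ 2) * (1 - x) := by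
      rw [pow_succ]
      exact mul_le_mul_of_nonneg_right ih (by linarith)
    have h2 : 0 ≤ (k : ℝ) ^ 2 * x ^ 3 := by positivity
    have h3 : 0 ≤ (k : ℝ) * x ^ 2 := by positivity
    push_cast
    nlinarith [sq_nonneg x]

theorem min_le_two_mul_one_sub_pow {x : ℝ} (hx0 : 0 ≤ x) (hx1 : x ≤ 1) (j : ℕ) :
    min (j * x) 1 ≤ 2 * (1 - (1 - x) ^ j) := by
  -- Bernoulli's inequality for `(1 + x) ^ j` bounds `(1 - x) ^ j` by `1 / (1 + j x)`.
  have h1 : (1 - x) ^ j * (1 + j * x) ≤ 1 := by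
    calc (1 - x) ^ j * (1 + j * x) ≤ (1 - x) ^ j * (1 + x) ^ j := by
          refine mul_le_mul_of_nonneg_left ?_ (pow_nonneg (by linarith) _)
          exact one_add_mul_le_pow (by linarith) j
      _ = (1 - x ^ 2) ^ j := by rw [← mul_pow]; ring
      _ ≤ 1 := pow_le_one₀ (by nlinarith) (by nlinarith)
  have h0 : 0 ≤ (1 - x) ^ j := pow_nonneg (by linarith) _
  have hj : 0 ≤ j * x := by positivity
  rcases le_total (j * x) 1 with h | h
  · rw [min_eq_left h]
    nlinarith
  · rw [min_eq_right h]
    nlinarith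

theorem pow_sub_eq_sum (x : ℝ) (k : ℕ) :
    (1 - x) ^ k - 1 + k * x = x * ∑ j ∈ Finset.range k, (1 - (1 - x) ^ j) := by
  induction k with
  | zero => simp
  | succ k ih =>
    rw [Finset.sum_range_succ, mul_add, ← ih]
    push_cast
    ring

/-- The term of `n² (f(1 - 1/n) - (1 - 1/n))` that belongs to `k` children. -/
def excessTerm (n k : ℕ) : ℝ := (n : ℝ) ^ 2 * ((1 - (n : ℝ)⁻¹) ^ k - 1 + k * (n : ℝ)⁻¹)

theorem inv_natCast_mem {n : ℕ} : 0 ≤ (n : ℝ)⁻¹ ∧ (n : ℝ)⁻¹ ≤ 1 :=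
  ⟨by positivity, Nat.cast_inv_le_one n⟩

theorem excessTerm_nonneg (n k : ℕ) : 0 ≤ excessTerm n k := by
  obtain ⟨h0, h1⟩ := inv_natCast_mem (n := n)
  rw [excessTerm, pow_sub_eq_sum]
  refine mul_nonneg (sq_nonneg _) (mul_nonneg h0 (Finset.sum_nonneg fun j _ => ?_))
  have := pow_le_one₀ (n := j) (by linarith : (0 : ℝ) ≤ 1 - (n : ℝ)⁻¹) (by linarith)
  linarith

theorem excessTerm_le {n : ℕ} (hn : 1 ≤ n) (k : ℕ) :
    excessTerm n k ≤ ((k * min k n : ℕ) : ℝ) := by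
  obtain ⟨h0, h1⟩ := inv_natCast_mem (n := n)
  have hn0 : (n : ℝ) ≠ 0 := by positivity
  have e : (n : ℝ) * (n : ℝ)⁻¹ = 1 := mul_inv_cancel₀ hn0
  push_cast
  rcases min_choice (k : ℝ) n with h | h
  · rw [h, excessTerm]
    have := one_sub_pow_le h0 h1 k
    calc (n : ℝ) ^ 2 * ((1 - (n : ℝ)⁻¹) ^ k - 1 + k * (n : ℝ)⁻¹)
        ≤ (n : ℝ) ^ 2 * (k * (n : ℝ)⁻¹) ^ 2 := by gcongr; linarith
      _ = (k * (n * (n : ℝ)⁻¹)) ^ 2 := by ring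
      _ = k * k := by rw [e]; ring
  · rw [h, excessTerm]
    have := pow_le_one₀ (n := k) (by linarith : (0 : ℝ) ≤ 1 - (n : ℝ)⁻¹) (by linarith)
    calc (n : ℝ) ^ 2 * ((1 - (n : ℝ)⁻¹) ^ k - 1 + k * (n : ℝ)⁻¹)
        ≤ (n : ℝ) ^ 2 * (k * (n : ℝ)⁻¹) := by gcongr; linarith
      _ = k * n * (n * (n : ℝ)⁻¹) := by ring
      _ = k * n := by rw [e, mul_one]

/-- The two powers with exponents `j` and `k - j` are paired, as in
`mul_min_le_two_mul_sum`. -/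
theorem mul_min_le_excessTerm {n : ℕ} (hn : 1 ≤ n) {k : ℕ} (hk : 2 ≤ k) :
    ((k * min k n : ℕ) : ℝ) ≤ 8 * excessTerm n k := by
  obtain ⟨h0, h1⟩ := inv_natCast_mem (n := n)
  have hn0 : (0 : ℝ) < n := by positivity
  have e : (n : ℝ) * (n : ℝ)⁻¹ = 1 := mul_inv_cancel₀ hn0.ne'
  obtain ⟨m, rfl⟩ : ∃ m, k = m + 1 := ⟨k - 1, by omega⟩
  have h2 := mul_min_le_two_mul_sum m n
  have h3 : (m + 1) * min (m + 1) n ≤ 4 * ∑ i ∈ Finset.range m, min (i + 1) n := by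
    calc (m + 1) * min (m + 1) n ≤ (2 * m) * min (m + 1) n :=
          Nat.mul_le_mul_right _ (by omega)
      _ = 2 * (m * min (m + 1) n) := by ring
      _ ≤ _ := by omega
  have h4 : ((∑ i ∈ Finset.range m, min (i + 1) n : ℕ) : ℝ) ≤ 2 * excessTerm n (m + 1) := by
    rw [excessTerm, pow_sub_eq_sum, Finset.sum_range_succ', Nat.cast_sum]
    calc ∑ i ∈ Finset.range m, ((min (i + 1) n : ℕ) : ℝ)
        ≤ ∑ i ∈ Finset.range m, 2 * (n * (1 - (1 - (n : ℝ)⁻¹) ^ (i + 1))) := by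
          refine Finset.sum_le_sum fun i _ => ?_
          have h5 := mul_le_mul_of_nonneg_left
            (min_le_two_mul_one_sub_pow h0 h1 (i + 1)) hn0.le
          rw [mul_min_of_nonneg _ _ hn0.le] at h5
          have h6 : (n : ℝ) * (((i + 1 : ℕ) : ℝ) * (n : ℝ)⁻¹) = ((i + 1 : ℕ) : ℝ) := by
            rw [mul_left_comm, e, mul_one]
          rw [h6, mul_one] at h5
          rw [Nat.cast_min]
          linarith
      _ = 2 * (n * (n * (n : ℝ)⁻¹) *
            (∑ i ∈ Finset.range m, (1 - (1 - (n : ℝ)⁻¹) ^ (i + 1)))) := by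
          rw [← Finset.mul_sum, ← Finset.mul_sum, e, mul_one]
      _ = _ := by
          rw [pow_zero, sub_self, add_zero]
          ring
  calc (((m + 1) * min (m + 1) n : ℕ) : ℝ)
      ≤ ((4 * ∑ i ∈ Finset.range m, min (i + 1) n : ℕ) : ℝ) := by exact_mod_cast h3
    _ = 4 * ((∑ i ∈ Finset.range m, min (i + 1) n : ℕ) : ℝ) := by
        rw [Nat.cast_mul, Nat.cast_ofNat]
    _ ≤ _ := by linarith

/-- The excess `f(1 - 1/n) - (1 - 1/n)` of the generating function. -/
def excess (π : PMF ℕ) (n : ℕ) : ℝ := genFun π (1 - (n : ℝ)⁻¹) - (1 - (n : ℝ)⁻¹)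

theorem hasSum_toReal (π : PMF ℕ) : HasSum (fun k => (π k).toReal) 1 := by
  have h := ENNReal.hasSum_toReal (f := fun k => π k) (by rw [π.tsum_coe]; simp)
  rwa [← ENNReal.tsum_toReal_eq π.apply_ne_top, π.tsum_coe, ENNReal.toReal_one] at h

theorem hasSum_mul_toReal {π : PMF ℕ} (h : IsCritical π) :
    HasSum (fun k : ℕ => (k : ℝ) * (π k).toReal) 1 := by
  have h1 : ∑' k : ℕ, (k : ℝ≥0∞) * π k = 1 := h
  have h2 := ENNReal.hasSum_toReal (f := fun k : ℕ => (k : ℝ≥0∞) * π k) (by rw [h1]; simp)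
  rw [← ENNReal.tsum_toReal_eq fun k => ENNReal.mul_ne_top (ENNReal.natCast_ne_top k)
    (π.apply_ne_top k), h1, ENNReal.toReal_one] at h2
  simpa using h2

theorem hasSum_excessTerm {π : PMF ℕ} (h : IsCritical π) (n : ℕ) :
    HasSum (fun k => (π k).toReal * excessTerm n k) ((n : ℝ) ^ 2 * excess π n) := by
  obtain ⟨h0, h1⟩ := inv_natCast_mem (n := n)
  have hs : Summable fun k => (π k).toReal * (1 - (n : ℝ)⁻¹) ^ k := by
    refine Summable.of_nonneg_of_le (fun k => ?_) (fun k => ?_) (hasSum_toReal π).summable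
    · exact mul_nonneg ENNReal.toReal_nonneg (pow_nonneg (by linarith) _)
    · exact mul_le_of_le_one_right ENNReal.toReal_nonneg
        (pow_le_one₀ (by linarith) (by linarith))
  have h2 := (((hs.hasSum.sub (hasSum_toReal π)).add
    ((hasSum_mul_toReal h).mul_right (n : ℝ)⁻¹)).mul_left ((n : ℝ) ^ 2))
  have e1 : (n : ℝ) ^ 2 * excess π n = (n : ℝ) ^ 2 *
      (∑' k, (π k).toReal * (1 - (n : ℝ)⁻¹) ^ k - 1 + 1 * (n : ℝ)⁻¹) := by
    rw [excess, genFun]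
    ring
  rw [e1]
  refine h2.congr_fun fun k => ?_
  rw [excessTerm]
  ring

theorem ofReal_excess {π : PMF ℕ} (h : IsCritical π) (n : ℕ) :
    ENNReal.ofReal ((n : ℝ) ^ 2 * excess π n) =
      ∑' k, π k * ENNReal.ofReal (excessTerm n k) := by
  have hs := hasSum_excessTerm h n
  rw [← hs.tsum_eq, ENNReal.ofReal_tsum_of_nonneg
    (fun k => mul_nonneg ENNReal.toReal_nonneg (excessTerm_nonneg n k)) hs.summable]
  refine tsum_congr fun k => ?_
  rw [ENNReal.ofReal_mul ENNReal.toReal_nonneg, ENNReal.ofReal_toReal (π.apply_ne_top k)]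

theorem ofReal_excess_le {π : PMF ℕ} (h : IsCritical π) {n : ℕ} (hn : 1 ≤ n) :
    ENNReal.ofReal ((n : ℝ) ^ 2 * excess π n) ≤ meanSize π n := by
  rw [ofReal_excess h, meanSize_eq_tsum]
  refine ENNReal.tsum_le_tsum fun k => mul_le_mul_right ?_ _
  exact ENNReal.ofReal_le_of_le_toReal (by simpa using excessTerm_le hn k)

theorem meanSizeTwo_le {π : PMF ℕ} (h : IsCritical π) {n : ℕ} (hn : 1 ≤ n) :
    meanSizeTwo π n ≤ 8 * ENNReal.ofReal ((n : ℝ) ^ 2 * excess π n) := by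
  rw [ofReal_excess h, meanSizeTwo, childSum, ← ENNReal.tsum_mul_left]
  refine ENNReal.tsum_le_tsum fun k => ?_
  rw [mul_left_comm]
  refine mul_le_mul_right ?_ _
  rw [Finset.sum_const, Finset.card_range, nsmul_eq_mul]
  split_ifs with hk
  · have h8 : (8 : ℝ≥0∞) = ENNReal.ofReal 8 := by simp
    rw [← Nat.cast_mul, h8, ← ENNReal.ofReal_mul (by norm_num), ← ENNReal.ofReal_natCast]
    exact ENNReal.ofReal_le_ofReal (mul_min_le_excessTerm hn hk)
  · simp

/-! ### Two-sided bounds in the real numbers -/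

theorem meanSize_ne_top {π : PMF ℕ} (h : IsCritical π) (n : ℕ) : meanSize π n ≠ ∞ :=
  ((meanSize_le h n).trans_lt (ENNReal.natCast_lt_top n)).ne

theorem one_le_toReal_meanSize {π : PMF ℕ} (h : IsCritical π) {n : ℕ} (hn : 1 ≤ n) :
    1 ≤ (meanSize π n).toReal := by
  have := ENNReal.toReal_mono (meanSize_ne_top h n) (one_le_meanSize h hn)
  simpa using this

theorem expectedVolume_ne_top {π : PMF ℕ} (h : IsCritical π) {n : ℕ} (hn : 1 ≤ n) :
    expectedVolume π h n ≠ ∞ := by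
  have h1 : expectedVolume π h n * 1 ≤ 528 * (n : ℝ≥0∞) ^ 2 :=
    (mul_le_mul_right (one_le_meanSize h hn) _).trans (expectedVolume_mul_meanSize_le h hn)
  rw [mul_one] at h1
  refine (h1.trans_lt ?_).ne
  exact ENNReal.mul_lt_top (by simp) (ENNReal.pow_lt_top (ENNReal.natCast_lt_top n))

theorem toReal_expectedVolume_mul_le {π : PMF ℕ} (h : IsCritical π) {n : ℕ} (hn : 1 ≤ n) :
    (expectedVolume π h n).toReal * (meanSize π n).toReal ≤ 528 * (n : ℝ) ^ 2 := by
  have h1 := ENNReal.toReal_mono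
    (ENNReal.mul_ne_top (by simp) (ENNReal.pow_ne_top (ENNReal.natCast_ne_top n)))
    (expectedVolume_mul_meanSize_le h hn)
  simpa using h1

/-- The mass `1 - π₁`, the constant in the lower bounds. -/
def defect (π : PMF ℕ) : ℝ := (1 - π 1).toReal

theorem defect_pos {π : PMF ℕ} (hne : π 1 ≠ 1) : 0 < defect π := by
  refine ENNReal.toReal_pos ?_ (by simp)
  exact (tsub_pos_of_lt (lt_of_le_of_ne (π.coe_le_one 1) hne)).ne'

theorem le_toReal_expectedVolume_mul {π : PMF ℕ} (h : IsCritical π) {n : ℕ} (hn : 1 ≤ n) :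
    defect π * (n : ℝ) ^ 2 ≤
      128 * ((expectedVolume π h n).toReal * (meanSize π n).toReal) := by
  have h1 := ENNReal.toReal_mono
    (ENNReal.mul_ne_top (by simp)
      (ENNReal.mul_ne_top (expectedVolume_ne_top h hn) (meanSize_ne_top h n)))
    (le_expectedVolume_mul_meanSize h hn)
  simpa [defect] using h1

/-- Together with `defect_mul_le`: the excess is of order `meanSize π n / n²`. -/
theorem sq_mul_excess_le {π : PMF ℕ} (h : IsCritical π) {n : ℕ} (hn : 1 ≤ n) :
    (n : ℝ) ^ 2 * excess π n ≤ (meanSize π n).toReal :=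
  (ENNReal.ofReal_le_iff_le_toReal (meanSize_ne_top h n)).1 (ofReal_excess_le h hn)

theorem defect_mul_le {π : PMF ℕ} (h : IsCritical π) {n : ℕ} (hn : 1 ≤ n) :
    defect π * (meanSize π n).toReal ≤ 8 * ((n : ℝ) ^ 2 * excess π n) := by
  have h1 := ENNReal.toReal_mono (ENNReal.mul_ne_top (by simp) ENNReal.ofReal_ne_top)
    ((mul_meanSize_le h hn).trans (meanSizeTwo_le h hn))
  have h2 : 0 ≤ (n : ℝ) ^ 2 * excess π n :=
    (hasSum_excessTerm h n).nonneg fun k =>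
      mul_nonneg ENNReal.toReal_nonneg (excessTerm_nonneg n k)
  rw [ENNReal.toReal_mul, ENNReal.toReal_mul, ENNReal.toReal_ofReal h2] at h1
  simpa [defect] using h1

theorem excess_pos {π : PMF ℕ} (h : IsCritical π) (hne : π 1 ≠ 1) {n : ℕ} (hn : 1 ≤ n) :
    0 < excess π n := by
  have h1 := defect_mul_le h hn
  have h2 := mul_pos (defect_pos hne) (one_pos.trans_le (one_le_toReal_meanSize h hn))
  have h3 : 0 < (n : ℝ) ^ 2 * excess π n := by linarith
  exact pos_of_mul_pos_right h3 (sq_nonneg _)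

theorem toReal_expectedVolume_mul_excess_le {π : PMF ℕ} (h : IsCritical π) {n : ℕ}
    (hn : 1 ≤ n) : (expectedVolume π h n).toReal * excess π n ≤ 528 := by
  have hn0 : (0 : ℝ) < (n : ℝ) ^ 2 := by positivity
  have h1 := toReal_expectedVolume_mul_le h hn
  have h2 := mul_le_mul_of_nonneg_left (sq_mul_excess_le h hn)
    (ENNReal.toReal_nonneg (a := expectedVolume π h n))
  refine le_of_mul_le_mul_right ?_ hn0
  linarith

theorem le_toReal_expectedVolume_mul_excess {π : PMF ℕ} (h : IsCritical π) {n : ℕ}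
    (hn : 1 ≤ n) :
    defect π ^ 2 / 1024 ≤ (expectedVolume π h n).toReal * excess π n := by
  have hn0 : (0 : ℝ) < (n : ℝ) ^ 2 := by positivity
  have hd : 0 ≤ defect π := ENNReal.toReal_nonneg
  have h1 := mul_le_mul_of_nonneg_left (le_toReal_expectedVolume_mul h hn) hd
  have h2 := mul_le_mul_of_nonneg_left (defect_mul_le h hn)
    (ENNReal.toReal_nonneg (a := expectedVolume π h n))
  refine le_of_mul_le_mul_right ?_ hn0
  nlinarith

/-! ### Consequences of regular variation -/

/-- The truncated second moment. -/
def truncMoment (π : PMF ℕ) (n : ℕ) : ℝ :=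
  ∑ i ∈ Finset.range (n + 1), (i : ℝ) ^ 2 * (π i).toReal

theorem truncMoment_mono (π : PMF ℕ) : Monotone (truncMoment π) := fun m n h =>
  Finset.sum_le_sum_of_subset_of_nonneg (Finset.range_mono (by omega))
    fun _ _ _ => mul_nonneg (sq_nonneg _) ENNReal.toReal_nonneg

theorem truncMoment_nonneg (π : PMF ℕ) (n : ℕ) : 0 ≤ truncMoment π n :=
  Finset.sum_nonneg fun _ _ => mul_nonneg (sq_nonneg _) ENNReal.toReal_nonneg

theorem ofReal_truncMoment (π : PMF ℕ) (n : ℕ) :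
    ENNReal.ofReal (truncMoment π n) =
      ∑' k, π k * if k ≤ n then ((k ^ 2 : ℕ) : ℝ≥0∞) else 0 := by
  rw [tsum_eq_sum (s := Finset.range (n + 1)), truncMoment, ENNReal.ofReal_sum_of_nonneg]
  · refine Finset.sum_congr rfl fun k hk => ?_
    rw [if_pos (by simpa [Nat.lt_succ_iff] using hk), mul_comm,
      ENNReal.ofReal_mul ENNReal.toReal_nonneg, ENNReal.ofReal_toReal (π.apply_ne_top k),
      ← Nat.cast_pow, ENNReal.ofReal_natCast]
  · exact fun i _ => mul_nonneg (sq_nonneg _) ENNReal.toReal_nonneg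
  · intro k hk
    rw [if_neg (by simpa [Nat.lt_succ_iff] using hk), mul_zero]

theorem truncMoment_le_meanSize {π : PMF ℕ} (h : IsCritical π) (n : ℕ) :
    truncMoment π n ≤ (meanSize π n).toReal := by
  rw [← ENNReal.ofReal_le_iff_le_toReal (meanSize_ne_top h n), ofReal_truncMoment,
    meanSize_eq_tsum]
  refine ENNReal.tsum_le_tsum fun k => mul_le_mul_right ?_ _
  split_ifs with hk
  · rw [min_eq_left hk, sq]
  · exact zero_le

theorem tendsto_truncMoment_ratio {π : PMF ℕ} {α : ℝ} (hdom : StableDomain π α) :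
    Tendsto (fun j : ℕ => truncMoment π (2 ^ (j + 1)) / truncMoment π (2 ^ j)) atTop
      (𝓝 (2 ^ (2 - α) : ℝ)) := by
  obtain ⟨L₁, ⟨_, hL⟩, hV⟩ := hdom
  have h2 : Tendsto (fun j : ℕ => (2 : ℝ) ^ j) atTop atTop :=
    tendsto_pow_atTop_atTop_of_one_lt one_lt_two
  have h3 := ((hL 2 two_pos).comp h2).const_mul ((2 : ℝ) ^ (2 - α))
  rw [mul_one] at h3
  refine h3.congr fun j => ?_
  have hpos : (0 : ℝ) < 2 ^ j := by positivity
  have e1 : truncMoment π (2 ^ j) = ((2 : ℝ) ^ j) ^ (2 - α) * L₁ (2 ^ j) := by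
    have := hV (2 ^ j) Nat.one_le_two_pow
    rw [truncMoment, this]
    push_cast
    rfl
  have e2 : truncMoment π (2 ^ (j + 1)) =
      2 ^ (2 - α) * ((2 : ℝ) ^ j) ^ (2 - α) * L₁ (2 * 2 ^ j) := by
    have := hV (2 ^ (j + 1)) Nat.one_le_two_pow
    rw [truncMoment, this]
    push_cast
    rw [pow_succ' (2 : ℝ) j, Real.mul_rpow two_pos.le hpos.le]
  have hne : ((2 : ℝ) ^ j) ^ (2 - α) ≠ 0 := (Real.rpow_pos_of_pos hpos _).ne'
  rw [e1, e2, Function.comp_apply, mul_comm ((2 : ℝ) ^ (2 - α)) (((2 : ℝ) ^ j) ^ (2 - α)),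
    mul_assoc, mul_div_mul_left _ _ hne, mul_div_assoc]

theorem mul_min_le_rpow {β : ℝ} (hβ1 : 1 ≤ β) (hβ2 : β ≤ 2) {k n : ℕ} (hn : 1 ≤ n) :
    ((k * min k n : ℕ) : ℝ) ≤ (n : ℝ) ^ (2 - β) * (k : ℝ) ^ β := by
  rcases Nat.eq_zero_or_pos k with rfl | hk
  · simp only [zero_mul, Nat.cast_zero]
    positivity
  have hk0 : (0 : ℝ) < k := by exact_mod_cast hk
  have hn0 : (0 : ℝ) < n := by exact_mod_cast hn
  rcases le_total k n with hkn | hkn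
  · have hkn' : (k : ℝ) ≤ n := by exact_mod_cast hkn
    rw [min_eq_left hkn]
    calc ((k * k : ℕ) : ℝ) = (k : ℝ) ^ (2 - β) * (k : ℝ) ^ β := by
          rw [← Real.rpow_add hk0, sub_add_cancel, Real.rpow_two]
          push_cast
          ring
      _ ≤ _ := by gcongr
  · have hkn' : (n : ℝ) ≤ k := by exact_mod_cast hkn
    rw [min_eq_right hkn]
    calc ((k * n : ℕ) : ℝ) = (n : ℝ) ^ (2 - β) * ((n : ℝ) ^ (β - 1) * k) := by
          rw [← mul_assoc, ← Real.rpow_add hn0, show 2 - β + (β - 1) = 1 by ring, Real.rpow_one]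
          push_cast
          ring
      _ ≤ (n : ℝ) ^ (2 - β) * ((k : ℝ) ^ (β - 1) * k) := by gcongr
      _ = _ := by rw [← Real.rpow_add_one hk0.ne', sub_add_cancel]

theorem summable_truncMoment {π : PMF ℕ} {α β : ℝ} (hdom : StableDomain π α) (hβ : β < α) :
    Summable fun j : ℕ => ((2 : ℝ) ^ j) ^ (β - 2) * truncMoment π (2 ^ (j + 1)) := by
  have hr := tendsto_truncMoment_ratio hdom
  have hr' := ((tendsto_add_atTop_iff_nat 1).2 hr).const_mul ((2 : ℝ) ^ (β - 2))
  have hlim : (2 : ℝ) ^ (β - 2) * 2 ^ (2 - α) < 1 := by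
    rw [← Real.rpow_add two_pos]
    exact Real.rpow_lt_one_of_one_lt_of_neg one_lt_two (by linarith)
  have hne : ∀ᶠ j : ℕ in atTop, truncMoment π (2 ^ (j + 1)) ≠ 0 := by
    filter_upwards [hr.eventually_ne (Real.rpow_pos_of_pos two_pos _).ne'] with j hj h0
    exact hj (by rw [h0, zero_div])
  refine summable_of_ratio_test_tendsto_lt_one hlim ?_ (hr'.congr fun j => ?_)
  · filter_upwards [hne] with j hj
    exact mul_ne_zero (Real.rpow_pos_of_pos (by positivity) _).ne' hj
  · have hpos : (0 : ℝ) < 2 ^ j := by positivity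
    have hp : 0 < ((2 : ℝ) ^ j) ^ (β - 2) := Real.rpow_pos_of_pos hpos _
    have hp' : 0 < ((2 : ℝ) ^ (j + 1)) ^ (β - 2) := Real.rpow_pos_of_pos (by positivity) _
    rw [Real.norm_of_nonneg (mul_nonneg hp.le (truncMoment_nonneg π _)),
      Real.norm_of_nonneg (mul_nonneg hp'.le (truncMoment_nonneg π _)),
      pow_succ' (2 : ℝ) j, Real.mul_rpow two_pos.le hpos.le,
      mul_comm ((2 : ℝ) ^ (β - 2)) (((2 : ℝ) ^ j) ^ (β - 2)), mul_assoc,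
      mul_div_mul_left _ _ hp.ne', mul_div_assoc]

/-- Moments of order less than `α` are finite. -/
theorem tsum_rpow_ne_top {π : PMF ℕ} {α β : ℝ} (hdom : StableDomain π α) (hβ0 : 0 < β)
    (hβ : β < α) (hβ2 : β ≤ 2) : ∑' k, π k * ENNReal.ofReal ((k : ℝ) ^ β) ≠ ∞ := by
  refine ne_top_of_le_ne_top (summable_truncMoment hdom hβ).tsum_ofReal_ne_top ?_
  have h1 : ∀ j : ℕ, ENNReal.ofReal (((2 : ℝ) ^ j) ^ (β - 2) * truncMoment π (2 ^ (j + 1))) =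
      ∑' k, π k * (ENNReal.ofReal (((2 : ℝ) ^ j) ^ (β - 2)) *
        if k ≤ 2 ^ (j + 1) then ((k ^ 2 : ℕ) : ℝ≥0∞) else 0) := fun j => by
    rw [ENNReal.ofReal_mul (Real.rpow_nonneg (by positivity) _), ofReal_truncMoment,
      ← ENNReal.tsum_mul_left]
    exact tsum_congr fun k => mul_left_comm _ _ _
  simp only [h1]
  rw [ENNReal.tsum_comm]
  refine ENNReal.tsum_le_tsum fun k => ?_
  rw [ENNReal.tsum_mul_left]
  refine mul_le_mul_right ?_ _
  rcases Nat.eq_zero_or_pos k with rfl | hk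
  · simp [Real.zero_rpow hβ0.ne']
  -- The summand of the dyadic block containing `k` alone suffices.
  refine le_trans ?_ (ENNReal.le_tsum (Nat.log 2 k))
  rw [if_pos (Nat.lt_pow_succ_log_self one_lt_two k).le, ← ENNReal.ofReal_natCast,
    ← ENNReal.ofReal_mul (Real.rpow_nonneg (by positivity) _)]
  refine ENNReal.ofReal_le_ofReal ?_
  have hk0 : (0 : ℝ) < k := by exact_mod_cast hk
  have hle : (2 : ℝ) ^ Nat.log 2 k ≤ k := by exact_mod_cast Nat.pow_log_le_self 2 hk.ne'
  calc (k : ℝ) ^ β = (k : ℝ) ^ (β - 2) * ((k ^ 2 : ℕ) : ℝ) := by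
        rw [Nat.cast_pow, ← Real.rpow_two, ← Real.rpow_add hk0, sub_add_cancel]
    _ ≤ _ := by
        refine mul_le_mul_of_nonneg_right ?_ (Nat.cast_nonneg _)
        exact Real.rpow_le_rpow_of_nonpos (by positivity) hle (by linarith)

theorem exists_meanSize_le_rpow {π : PMF ℕ} {α β : ℝ}
    (hdom : StableDomain π α) (hβ1 : 1 ≤ β) (hβ : β < α) (hα : α ≤ 2) :
    ∃ M : ℝ, ∀ n : ℕ, 1 ≤ n → (meanSize π n).toReal ≤ M * (n : ℝ) ^ (2 - β) := by
  have hfin := tsum_rpow_ne_top hdom (by linarith) hβ (by linarith)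
  refine ⟨(∑' k, π k * ENNReal.ofReal ((k : ℝ) ^ β)).toReal, fun n hn => ?_⟩
  have hp : 0 ≤ (n : ℝ) ^ (2 - β) := by positivity
  have h1 : meanSize π n ≤
      (∑' k, π k * ENNReal.ofReal ((k : ℝ) ^ β)) * ENNReal.ofReal ((n : ℝ) ^ (2 - β)) := by
    rw [meanSize_eq_tsum, ← ENNReal.tsum_mul_right]
    refine ENNReal.tsum_le_tsum fun k => ?_
    rw [mul_assoc]
    refine mul_le_mul_right ?_ _
    rw [mul_comm (ENNReal.ofReal _), ← ENNReal.ofReal_mul hp, ← ENNReal.ofReal_natCast]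
    exact ENNReal.ofReal_le_ofReal (mul_min_le_rpow hβ1 (by linarith) hn)
  have h2 := ENNReal.toReal_mono (ENNReal.mul_ne_top hfin ENNReal.ofReal_ne_top) h1
  rwa [ENNReal.toReal_mul, ENNReal.toReal_ofReal hp] at h2

/-- The truncated second moment grows geometrically along powers of `2`, and is monotone in
between. -/
theorem exists_rpow_le_truncMoment {π : PMF ℕ} {α γ : ℝ} (hdom : StableDomain π α)
    (hγ : γ < 2 - α) :
    ∃ c : ℝ, 0 < c ∧ ∀ᶠ n : ℕ in atTop, c * (n : ℝ) ^ γ ≤ truncMoment π n := by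
  have hr := tendsto_truncMoment_ratio hdom
  have hlt : (2 : ℝ) ^ γ < 2 ^ (2 - α) := Real.rpow_lt_rpow_of_exponent_lt one_lt_two hγ
  obtain ⟨J, hJ⟩ := eventually_atTop.1 (hr.eventually_const_lt hlt)
  have hg : 0 < (2 : ℝ) ^ γ := Real.rpow_pos_of_pos two_pos _
  have hpos : 0 < truncMoment π (2 ^ J) := by
    refine lt_of_le_of_ne (truncMoment_nonneg π _) fun h0 => ?_
    have := hJ J le_rfl
    rw [← h0, div_zero] at this
    linarith
  set c := truncMoment π (2 ^ J) / ((2 : ℝ) ^ γ) ^ J with hc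
  have hc0 : 0 < c := by positivity
  have hind : ∀ j, J ≤ j → c * ((2 : ℝ) ^ γ) ^ j ≤ truncMoment π (2 ^ j) := by
    intro j hj
    induction j, hj using Nat.le_induction with
    | base => rw [hc, div_mul_cancel₀ _ (by positivity)]
    | succ j hj ih =>
      have hpj : 0 < truncMoment π (2 ^ j) := lt_of_lt_of_le (by positivity) ih
      have h1 := (lt_div_iff₀ hpj).1 (hJ j hj)
      rw [pow_succ']
      nlinarith
  refine ⟨c / 2 ^ |γ|, by positivity, ?_⟩
  filter_upwards [eventually_ge_atTop (2 ^ J)] with n hn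
  have hn1 : 1 ≤ n := Nat.one_le_two_pow.trans hn
  have hn0 : (0 : ℝ) < n := by exact_mod_cast hn1
  set j := Nat.log 2 n with hj
  have hjJ : J ≤ j := Nat.le_log_of_pow_le one_lt_two hn
  have h1 : 2 ^ j ≤ n := Nat.pow_log_le_self 2 (by omega)
  have h2 : n < 2 ^ (j + 1) := Nat.lt_pow_succ_log_self one_lt_two n
  have h2j : (0 : ℝ) < 2 ^ j := by positivity
  have h1' : (2 : ℝ) ^ j ≤ n := by exact_mod_cast h1
  have h2' : (n : ℝ) ≤ 2 * 2 ^ j := by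
    rw [← pow_succ']
    exact_mod_cast h2.le
  have h3 : ((n : ℝ) / 2 ^ j) ^ γ ≤ 2 ^ |γ| :=
    calc ((n : ℝ) / 2 ^ j) ^ γ ≤ ((n : ℝ) / 2 ^ j) ^ |γ| :=
          Real.rpow_le_rpow_of_exponent_le ((one_le_div h2j).2 h1') (le_abs_self γ)
      _ ≤ 2 ^ |γ| := Real.rpow_le_rpow (by positivity) ((div_le_iff₀ h2j).2 h2') (abs_nonneg γ)
  rw [Real.div_rpow hn0.le h2j.le, div_le_iff₀ (Real.rpow_pos_of_pos h2j _)] at h3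
  have h4 : ((2 : ℝ) ^ j) ^ γ = ((2 : ℝ) ^ γ) ^ j := by
    rw [← Real.rpow_natCast, ← Real.rpow_natCast, ← Real.rpow_mul two_pos.le,
      ← Real.rpow_mul two_pos.le, mul_comm]
  calc c / 2 ^ |γ| * (n : ℝ) ^ γ ≤ c / 2 ^ |γ| * (2 ^ |γ| * ((2 : ℝ) ^ j) ^ γ) := by gcongr
    _ = c * ((2 : ℝ) ^ γ) ^ j := by rw [h4]; field_simp
    _ ≤ truncMoment π (2 ^ j) := hind j hjJ
    _ ≤ truncMoment π n := truncMoment_mono π h1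

/-! ### Growth exponents -/

theorem tendsto_add_mul_log_div (a b : ℝ) :
    Tendsto (fun n : ℕ => (a + b * Real.log n) / Real.log n) atTop (𝓝 b) := by
  have hlog : Tendsto (fun n : ℕ => Real.log n) atTop atTop :=
    Real.tendsto_log_atTop.comp tendsto_natCast_atTop_atTop
  have h1 := (hlog.const_div_atTop a).add_const b
  rw [zero_add] at h1
  refine h1.congr' ?_
  filter_upwards [hlog.eventually_gt_atTop 0] with n hn
  rw [add_div, mul_div_cancel_right₀ _ hn.ne']

/-- A sequence that is bounded below by all smaller powers and above by all larger powers of `n`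
has growth exponent `α`; the lower bounds are only needed for exponents in `(l, α)`. -/
theorem tendsto_log_div_log {T : ℕ → ℝ} {α l : ℝ} (hl : l < α)
    (hlow : ∀ β, l < β → β < α → ∃ c : ℝ, 0 < c ∧ ∀ᶠ n : ℕ in atTop, c * (n : ℝ) ^ β ≤ T n)
    (hupp : ∀ β, α < β → ∃ C : ℝ, 0 < C ∧ ∀ᶠ n : ℕ in atTop, T n ≤ C * (n : ℝ) ^ β) :
    Tendsto (fun n : ℕ => Real.log (T n) / Real.log n) atTop (𝓝 α) := by
  have hpos : ∀ᶠ n : ℕ in atTop, 0 < T n := by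
    obtain ⟨β, h1, h2⟩ := exists_between hl
    obtain ⟨c, hc, h⟩ := hlow β h1 h2
    filter_upwards [h, eventually_ge_atTop 1] with n hn hn1
    exact lt_of_lt_of_le (by positivity) hn
  have hlogpos : ∀ᶠ n : ℕ in atTop, 0 < Real.log n := by
    filter_upwards [eventually_ge_atTop 2] with n hn
    exact Real.log_pos (by exact_mod_cast hn)
  have key : ∀ (C β : ℝ) (n : ℕ), 0 < C → 1 ≤ n →
      Real.log (C * (n : ℝ) ^ β) = Real.log C + β * Real.log n := fun C β n hC hn => by
    have hn0 : (0 : ℝ) < n := by exact_mod_cast hn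
    rw [Real.log_mul hC.ne' (Real.rpow_pos_of_pos hn0 _).ne', Real.log_rpow hn0]
  refine tendsto_order.2 ⟨fun a ha => ?_, fun a ha => ?_⟩
  · obtain ⟨β, h1, h2⟩ := exists_between (max_lt ha hl)
    obtain ⟨c, hc, h⟩ := hlow β ((le_max_right _ _).trans_lt h1) h2
    filter_upwards [h, eventually_ge_atTop 1, hlogpos,
      (tendsto_add_mul_log_div (Real.log c) β).eventually_const_lt
        ((le_max_left _ _).trans_lt h1)] with n hn hn1 hlog hlt
    refine hlt.trans_le ?_
    rw [← key c β n hc hn1]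
    gcongr
  · obtain ⟨β, h1, h2⟩ := exists_between ha
    obtain ⟨C, hC, h⟩ := hupp β h1
    filter_upwards [h, eventually_ge_atTop 1, hlogpos, hpos,
      (tendsto_add_mul_log_div (Real.log C) β).eventually_lt_const h2]
      with n hn hn1 hlog hT hlt
    refine lt_of_le_of_lt ?_ hlt
    rw [← key C β n hC hn1]
    gcongr

theorem exists_bounds_of_tendsto_one {q : ℕ → ℝ} (hq : Tendsto q atTop (𝓝 1))
    (hpos : ∀ n, 1 ≤ n → 0 < q n) :
    ∃ m M : ℝ, 0 < m ∧ 0 < M ∧ ∀ n, 1 ≤ n → m ≤ q n ∧ q n ≤ M := by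
  obtain ⟨M, hM⟩ := hq.bddAbove_range
  -- A positive lower bound for `q` is an upper bound for its inverse.
  obtain ⟨B, hB⟩ := (hq.inv₀ one_ne_zero).bddAbove_range
  have hM' : ∀ n, q n ≤ M := fun n => hM ⟨n, rfl⟩
  have hB' : ∀ n, (q n)⁻¹ ≤ B := fun n => hB ⟨n, rfl⟩
  have hB0 : 0 < B := (inv_pos.2 (hpos 1 le_rfl)).trans_le (hB' 1)
  refine ⟨B⁻¹, M, inv_pos.2 hB0, (hpos 1 le_rfl).trans_le (hM' 1), fun n hn => ⟨?_, hM' n⟩⟩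
  exact inv_le_of_inv_le₀ (hpos n hn) (hB' n)

/-- The power `n ^ α` cancels the one in the definition of `slowL`. -/
theorem rpow_mul_inv_slowL (π : PMF ℕ) (α : ℝ) {n : ℕ} (hn : 1 ≤ n) :
    (n : ℝ) ^ α * (slowL π α n)⁻¹ = (excess π n)⁻¹ := by
  have hn0 : (0 : ℝ) < n := by exact_mod_cast hn
  have h1 : (n : ℝ) ^ α ≠ 0 := (Real.rpow_pos_of_pos hn0 α).ne'
  rw [slowL, mul_inv, ← mul_assoc, mul_inv_cancel₀ h1, one_mul, excess]

theorem tendsto_log_expectedVolume {π : PMF ℕ} (h : IsCritical π) (hne : π 1 ≠ 1) {α : ℝ}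
    (hα₁ : 1 < α) (hα₂ : α ≤ 2) (hdom : StableDomain π α) :
    Tendsto (fun n : ℕ => Real.log (expectedVolume π h n).toReal / Real.log n)
      atTop (𝓝 α) := by
  refine tendsto_log_div_log hα₁ (fun β hβ1 hβ => ?_) fun β hβ => ?_
  · obtain ⟨M, hM⟩ := exists_meanSize_le_rpow hdom hβ1.le hβ hα₂
    have hM0 : 0 < M := by
      have h1 := (one_le_toReal_meanSize h le_rfl).trans (hM 1 le_rfl)
      simp only [Nat.cast_one, Real.one_rpow, mul_one] at h1
      linarith
    have hd := defect_pos hne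
    refine ⟨defect π / (128 * M), by positivity, ?_⟩
    filter_upwards [eventually_ge_atTop 1] with n hn
    have hn0 : (0 : ℝ) < n := by exact_mod_cast hn
    have h2 := le_toReal_expectedVolume_mul h hn
    have h3 := mul_le_mul_of_nonneg_left (hM n hn)
      (ENNReal.toReal_nonneg (a := expectedVolume π h n))
    have hp : 0 < (n : ℝ) ^ (2 - β) := Real.rpow_pos_of_pos hn0 _
    have e : (n : ℝ) ^ 2 = (n : ℝ) ^ (2 - β) * (n : ℝ) ^ β := by
      rw [← Real.rpow_add hn0, sub_add_cancel, Real.rpow_two]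
    rw [e] at h2
    rw [div_mul_eq_mul_div, div_le_iff₀ (by positivity)]
    refine le_of_mul_le_mul_left ?_ hp
    linarith
  · obtain ⟨c, hc, hV⟩ := exists_rpow_le_truncMoment hdom (γ := 2 - β) (by linarith)
    refine ⟨528 / c, by positivity, ?_⟩
    filter_upwards [hV, eventually_ge_atTop 1] with n hVn hn
    have hn0 : (0 : ℝ) < n := by exact_mod_cast hn
    have h2 := toReal_expectedVolume_mul_le h hn
    have h3 := mul_le_mul_of_nonneg_left (hVn.trans (truncMoment_le_meanSize h n))
      (ENNReal.toReal_nonneg (a := expectedVolume π h n))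
    have hp : 0 < (n : ℝ) ^ (2 - β) := Real.rpow_pos_of_pos hn0 _
    have e : (n : ℝ) ^ 2 = (n : ℝ) ^ (2 - β) * (n : ℝ) ^ β := by
      rw [← Real.rpow_add hn0, sub_add_cancel, Real.rpow_two]
    rw [e] at h2
    rw [div_mul_eq_mul_div, le_div_iff₀ hc]
    refine le_of_mul_le_mul_left ?_ hp
    linarith

end Looptree

end

theorem mainTheorem5 (π : PMF ℕ) (α : ℝ) (hα₁ : 1 < α) (hα₂ : α ≤ 2)
    (hcrit : Looptree.IsCritical π) (hne : π 1 ≠ 1) (hdom : Looptree.StableDomain π α) :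
    (∀ a : ℕ → ℝ, (∀ n, 1 ≤ n → 0 < a n) →
      Asymptotics.IsEquivalent atTop a
        (fun n : ℕ => (n : ℝ) ^ α * (Looptree.slowL π α n)⁻¹) →
      ∃ k₁ k₂ : ℝ, 0 < k₁ ∧ 0 < k₂ ∧ ∀ n : ℕ, 1 ≤ n →
        ENNReal.ofReal (k₁ * a n) ≤ Looptree.expectedVolume π hcrit n ∧
        Looptree.expectedVolume π hcrit n ≤ ENNReal.ofReal (k₂ * a n)) ∧
    Tendsto (fun n : ℕ => Real.log (Looptree.expectedVolume π hcrit n).toReal / Real.log n)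
      atTop (𝓝 α) := by
  refine ⟨fun a ha hequiv => ?_,
    Looptree.tendsto_log_expectedVolume hcrit hne hα₁ hα₂ hdom⟩
  have hφ : ∀ n : ℕ, 1 ≤ n → 0 < Looptree.excess π n := fun n hn =>
    Looptree.excess_pos hcrit hne hn
  have hq : Tendsto (fun n => a n * Looptree.excess π n) atTop (𝓝 1) := by
    have hne0 : ∀ᶠ n : ℕ in atTop, (n : ℝ) ^ α * (Looptree.slowL π α n)⁻¹ ≠ 0 := by
      filter_upwards [eventually_ge_atTop 1] with n hn
      rw [Looptree.rpow_mul_inv_slowL π α hn]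
      exact (inv_pos.2 (hφ n hn)).ne'
    refine ((Asymptotics.isEquivalent_iff_tendsto_one hne0).1 hequiv).congr' ?_
    filter_upwards [eventually_ge_atTop 1] with n hn
    rw [Pi.div_apply, Looptree.rpow_mul_inv_slowL π α hn, div_inv_eq_mul]
  obtain ⟨m, M, hm, hM, hmM⟩ := Looptree.exists_bounds_of_tendsto_one hq fun n hn =>
    mul_pos (ha n hn) (hφ n hn)
  have hd := Looptree.defect_pos hne
  refine ⟨Looptree.defect π ^ 2 / 1024 / M, 528 / m, by positivity, by positivity,
    fun n hn => ⟨?_, ?_⟩⟩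
  · refine ENNReal.ofReal_le_of_le_toReal (le_of_mul_le_mul_right ?_ (hφ n hn))
    refine le_trans ?_ (Looptree.le_toReal_expectedVolume_mul_excess hcrit hn)
    rw [mul_assoc, div_mul_eq_mul_div, div_le_iff₀ hM]
    exact mul_le_mul_of_nonneg_left (hmM n hn).2 (by positivity)
  · rw [ENNReal.le_ofReal_iff_toReal_le (Looptree.expectedVolume_ne_top hcrit hn)
      (mul_nonneg (by positivity) (ha n hn).le)]
    refine le_of_mul_le_mul_right ?_ (hφ n hn)
    refine (Looptree.toReal_expectedVolume_mul_excess_le hcrit hn).trans ?_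
    rw [mul_assoc, div_mul_eq_mul_div, le_div_iff₀ hm]
    exact mul_le_mul_of_nonneg_left (hmM n hn).1 (by norm_num)
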